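/- Let $F$ be a set of functions $\mathbb R\to\mathbb R$ with $\mathrm{id}\in F$, whose elements are named by finite bit strings (distinct functions having distinct names), so that $F$-networks can be given as inputs to a Turing machine. An $F$-network $N$ consists of an ordered input layer of $n\ge 0$ nodes, a finite (possibly empty) sequence of hidden layers and an ordered output layer of $m\ge 0$ nodes; hidden layers may be empty. Each node $v$ outside the input layer carries an activation $\sigma_v\in F$, a rational bias $b_v$, and incoming edges with rational weights $c_{uv}$, all from nodes $u$ of earlier layers; it computes $y_v=\sigma_v\big(\sum_{u\to v}c_{uv}\,y_u+b_v\big)$, an empty sum being $0$. So $N$ computes a function $\mathbb R^n\to\mathbb R^m$. $N$ is called strict if every edge runs from a layer to the immediately following one. For a set $Y$ of hidden nodes, $N\setminus Y$ is the network obtained by deleting the nodes of $Y$ together with all their edges, keeping all other activations, biases and weights. $\mathrm{NE}(F)$: given two $F$-networks $N,M$, do they compute the same function (in particular, with the same input and output dimensions)? $\mathrm{NECE}(F)$: given an $F$-network $N$ and a set $Y$ of hidden nodes of $N$, is $Y$ necessary, i.e. do $N$ and $N\setminus Y$ compute different functions? Instances are written as words over a fixed finite alphabet: nodes are identified by bit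 strings, each node is listed layer by layer with its activation name, its bias and its incoming edges and their weights, rationals are written in binary, and $Y$ is given by marking its nodes. Problem $A$ is linear-time reducible to problem $B$ if there is a map $f$ from the instances of $A$ to those of $B$ with $I\in A\Leftrightarrow f(I)\in B$, computed by a deterministic multi-stack (equivalently, multi-tape) Turing machine in at most $c\,(\ell+1)$ steps on instances of encoding length $\ell$, for a constant $c$. Two problems are linear-time equivalent if each is linear-time reducible to the other. **Theorem.** (1) The complement of $\mathrm{NECE}(F)$ and $\mathrm{NE}(F)$ are linear-time equivalent. (2) The same holds within strict networks: the complement of $\mathrm{NECE}(F)$ restricted to strict networks, and $\mathrm{NE}(F)$ restricted to pairs of strict networks with the same number of layers, are linear-time equivalent. -/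

import Mathlib

noncomputable section

namespace NeuralNet

/-! ### Feedforward networks -/

/-- Nodes are named by bit strings. -/
abbrev NodeName := List Bool

/-- A computation node: its name, its activation function from `F`, its rational bias, and its
incoming edges, each given by the name of the source and the rational weight. -/
structure Node (F : Set (ℝ → ℝ)) where
  name : NodeName
  act : F
  bias : ℚ
  edges : List (NodeName × ℚ)

/-- The names of the nodes of a layer. -/
def layerNames {F : Set (ℝ → ℝ)} (l : List (Node F)) : List NodeName :=
  l.map Node.name

/-- Every node of every layer reads only nodes from earlier layers;
`earlier` lists the nodes that precede the first layer of the list. -/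
def FeedsForward {F : Set (ℝ → ℝ)} (earlier : List NodeName) : List (List (Node F)) → Prop
  | [] => True
  | l :: ls =>
      (∀ v ∈ l, ∀ e ∈ v.edges, e.1 ∈ earlier) ∧ FeedsForward (earlier ++ layerNames l) ls

/-- Every node of every layer reads only nodes from the layer immediately before;
`previous` is the layer that precedes the first layer of the list. -/
def FeedsConsecutively {F : Set (ℝ → ℝ)} (previous : List NodeName) :
    List (List (Node F)) → Prop
  | [] => True
  | l :: ls =>
      (∀ v ∈ l, ∀ e ∈ v.edges, e.1 ∈ previous) ∧ FeedsConsecutively (layerNames l) ls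

/-- A layered feedforward network with activations from `F` and rational weights and biases.
It has an input layer, any number of hidden layers and an output layer; a layer may be empty.
An edge that is not listed carries no weight. -/
structure Network (F : Set (ℝ → ℝ)) where
  /-- the names of the input nodes, in order -/
  inputs : List NodeName
  /-- the hidden layers, in order -/
  hidden : List (List (Node F))
  /-- the output layer -/
  output : List (Node F)
  names_nodup : (inputs ++ (hidden ++ [output]).flatMap layerNames).Nodup
  edges_nodup : ∀ l ∈ hidden ++ [output], ∀ v ∈ l, (v.edges.map Prod.fst).Nodup
  feedsForward : FeedsForward inputs (hidden ++ [output])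

variable {F : Set (ℝ → ℝ)}

/-- The value computed by a node, given the values of the nodes that it reads:
`σ (∑ weight * value + bias)`. -/
def Node.value (v : Node F) (val : NodeName → ℝ) : ℝ :=
  v.act.1 ((v.edges.map fun e => (e.2 : ℝ) * val e.1).sum + (v.bias : ℝ))

/-- Extend the values of the nodes by those of one more layer. -/
def runLayer (val : NodeName → ℝ) (l : List (Node F)) : NodeName → ℝ := fun s =>
  match l.find? (fun v => decide (v.name = s)) with
  | some v => v.value val
  | none => val s

namespace Network

/-- The input dimension. -/
def inDim (N : Network F) : ℕ := N.inputs.length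

/-- The output dimension. -/
def outDim (N : Network F) : ℕ := N.output.length

/-- The values of the input nodes on input `x`. -/
def inputValues (N : Network F) (x : Fin N.inDim → ℝ) : NodeName → ℝ := fun s =>
  if h : s ∈ N.inputs then x ⟨N.inputs.idxOf s, List.idxOf_lt_length_iff.2 h⟩ else 0

/-- The values of the input nodes and of the hidden nodes on input `x`. -/
def hiddenValues (N : Network F) (x : Fin N.inDim → ℝ) : NodeName → ℝ :=
  N.hidden.foldl runLayer (N.inputValues x)

/-- The function `ℝ ^ n → ℝ ^ m` that the network computes. -/
def compute (N : Network F) (x : Fin N.inDim → ℝ) : Fin N.outDim → ℝ := fun i =>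
  (N.output.get i).value (N.hiddenValues x)

/-- `N` and `M` compute the same function (in particular their dimensions agree). -/
def SameFunction (N M : Network F) : Prop :=
  ∃ (hn : M.inDim = N.inDim) (hm : N.outDim = M.outDim),
    ∀ (x : Fin N.inDim → ℝ) (i : Fin N.outDim),
      N.compute x i = M.compute (fun j => x (Fin.cast hn j)) (Fin.cast hm i)

/-- All edges run between consecutive layers. -/
def IsStrict (N : Network F) : Prop :=
  FeedsConsecutively N.inputs (N.hidden ++ [N.output])

/-- The names of the hidden nodes. -/
def hiddenNames (N : Network F) : List NodeName :=
  N.hidden.flatMap layerNames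

end Network

/-! ### Deletion of nodes -/

/-- Drop the edges that start in `Y`. -/
def Node.dropEdges (Y : Finset NodeName) (v : Node F) : Node F :=
  { v with edges := v.edges.filter fun e => decide (e.1 ∉ Y) }

/-- Drop the nodes in `Y` from a layer, with all their edges. -/
def dropNodes (Y : Finset NodeName) (l : List (Node F)) : List (Node F) :=
  (l.filter fun v => decide (v.name ∉ Y)).map (Node.dropEdges Y)

theorem layerNames_dropNodes (Y : Finset NodeName) (l : List (Node F)) :
    layerNames (dropNodes Y l) = (layerNames l).filter fun s => decide (s ∉ Y) := by
  simp only [layerNames, dropNodes, List.map_map, List.filter_map]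
  rfl

theorem layerNames_map_dropEdges (Y : Finset NodeName) (l : List (Node F)) :
    layerNames (l.map (Node.dropEdges Y)) = layerNames l := by
  simp only [layerNames, List.map_map]
  rfl

theorem feedsForward_delete (Y : Finset NodeName) (out : List (Node F)) :
    ∀ (hid : List (List (Node F))) (earlier earlier' : List NodeName),
      (∀ s ∈ earlier, s ∉ Y → s ∈ earlier') →
      FeedsForward earlier (hid ++ [out]) →
      FeedsForward earlier' (hid.map (dropNodes Y) ++ [out.map (Node.dropEdges Y)]) := by
  intro hid
  induction hid with
  | nil =>
    intro a a' h hf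
    refine ⟨?_, trivial⟩
    intro v hv e he
    obtain ⟨u, hu, rfl⟩ := List.mem_map.1 hv
    obtain ⟨h1, h2⟩ := List.mem_filter.1 he
    exact h _ (hf.1 u hu e h1) (of_decide_eq_true h2)
  | cons l ls ih =>
    intro a a' h hf
    refine ⟨?_, ih _ _ ?_ hf.2⟩
    · intro v hv e he
      obtain ⟨u, hu, rfl⟩ := List.mem_map.1 hv
      obtain ⟨h1, h2⟩ := List.mem_filter.1 he
      exact h _ (hf.1 u (List.mem_filter.1 hu).1 e h1) (of_decide_eq_true h2)
    · intro s hs hY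
      rcases List.mem_append.1 hs with hs | hs
      · exact List.mem_append.2 (Or.inl (h s hs hY))
      · refine List.mem_append.2 (Or.inr ?_)
        rw [layerNames_dropNodes]
        exact List.mem_filter.2 ⟨hs, decide_eq_true hY⟩

theorem names_delete_sublist (Y : Finset NodeName) (out : List (Node F)) :
    ∀ hid : List (List (Node F)),
      List.Sublist
        ((hid.map (dropNodes Y) ++ [out.map (Node.dropEdges Y)]).flatMap layerNames)
        ((hid ++ [out]).flatMap layerNames) := by
  intro hid
  induction hid with
  | nil => simp [layerNames_map_dropEdges]
  | cons l ls ih =>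
    simp only [List.map_cons, List.cons_append, List.flatMap_cons]
    refine List.Sublist.append ?_ ih
    rw [layerNames_dropNodes]
    exact List.filter_sublist

theorem edges_delete_nodup (Y : Finset NodeName) (v : Node F)
    (h : (v.edges.map Prod.fst).Nodup) : ((v.dropEdges Y).edges.map Prod.fst).Nodup :=
  h.sublist (List.Sublist.map _ List.filter_sublist)

/-- The network obtained from `N` by deleting the hidden nodes in `Y`: the subgraph induced by the
other nodes, with the same activations, biases and weights. -/
def Network.delete (N : Network F) (Y : Finset NodeName) : Network F where
  inputs := N.inputs
  hidden := N.hidden.map (dropNodes Y)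
  output := N.output.map (Node.dropEdges Y)
  names_nodup := N.names_nodup.sublist
    (List.Sublist.append (List.Sublist.refl _) (names_delete_sublist Y N.output N.hidden))
  edges_nodup := by
    intro l hl v hv
    rcases List.mem_append.1 hl with hl | hl
    · obtain ⟨l', hl', rfl⟩ := List.mem_map.1 hl
      obtain ⟨u, hu, rfl⟩ := List.mem_map.1 hv
      exact edges_delete_nodup Y u
        (N.edges_nodup l' (List.mem_append.2 (Or.inl hl')) u (List.mem_filter.1 hu).1)
    · rw [List.mem_singleton] at hl
      subst hl
      obtain ⟨u, hu, rfl⟩ := List.mem_map.1 hv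
      exact edges_delete_nodup Y u
        (N.edges_nodup N.output (List.mem_append.2 (Or.inr (List.mem_singleton.2 rfl))) u hu)
  feedsForward := feedsForward_delete Y N.output N.hidden _ _ (fun _ hs _ => hs) N.feedsForward

/-! ### Instances and their encoding over a finite alphabet -/

/-- The finite alphabet of the encodings. -/
inductive Sym where
  | bit (b : Bool)
  | mark (b : Bool)
  | sign (negative : Bool)
  | slash
  | input
  | layer
  | output
  | node
  | act
  | bias
  | edge
  | weight
  | next
  deriving DecidableEq, Fintype

/-- A bit string. -/
def encodeBits (s : List Bool) : List Sym := s.map Sym.bit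

/-- A rational number: sign, numerator and denominator in binary. -/
def encodeRat (q : ℚ) : List Sym :=
  Sym.sign (decide (q < 0)) :: encodeBits q.num.natAbs.bits ++ Sym.slash :: encodeBits q.den.bits

/-- An incoming edge: its source and its weight. -/
def encodeEdge (e : NodeName × ℚ) : List Sym :=
  Sym.edge :: encodeBits e.1 ++ Sym.weight :: encodeRat e.2

/-- A node, with a mark that tells whether it belongs to `Y`. Activation functions are written
down by their names `code`. -/
def encodeNode (code : F → List Bool) (Y : Finset NodeName) (v : Node F) : List Sym :=
  Sym.node :: Sym.mark (decide (v.name ∈ Y)) :: encodeBits v.name ++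
    Sym.act :: encodeBits (code v.act) ++ Sym.bias :: encodeRat v.bias ++
    v.edges.flatMap encodeEdge

/-- A network in which the nodes in `Y` are marked. -/
def encodeNetwork (code : F → List Bool) (N : Network F) (Y : Finset NodeName) : List Sym :=
  N.inputs.flatMap (fun s => Sym.input :: encodeBits s) ++
    N.hidden.flatMap (fun l => Sym.layer :: l.flatMap (encodeNode code Y)) ++
    Sym.output :: N.output.flatMap (encodeNode code Y)

/-- A network together with a set `Y` of hidden nodes of it. -/
structure NECEInstance (F : Set (ℝ → ℝ)) where
  N : Network F
  Y : Finset NodeName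
  hidden_Y : ∀ s ∈ Y, s ∈ N.hiddenNames

/-! ### Decision problems and linear-time reductions -/

/-- A decision problem: instances, written as words over the alphabet `Γ`, and the
yes-instances. -/
structure DecisionProblem (Γ : Type) where
  Inst : Type
  encode : Inst → List Γ
  yes : Inst → Prop

namespace DecisionProblem

variable {Γ : Type}

/-- The complement of a decision problem. -/
def compl (A : DecisionProblem Γ) : DecisionProblem Γ where
  Inst := A.Inst
  encode := A.encode
  yes I := ¬ A.yes I

/-- The restriction of a decision problem to the instances with property `p`. -/
def restrict (A : DecisionProblem Γ) (p : A.Inst → Prop) : DecisionProblem Γ where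
  Inst := {I : A.Inst // p I}
  encode I := A.encode I.1
  yes I := A.yes I.1

/-- `A` is many-one reducible to `B` by a function that a Turing machine (with finitely many stacks)
computes in a number of steps that is linear in the length of the input word. -/
def LinearTimeReducible (A B : DecisionProblem Γ) : Prop :=
  ∃ f : A.Inst → B.Inst, (∀ I, A.yes I ↔ B.yes (f I)) ∧
    ∃ (M : Turing.TM2ComputableInTime A.encode B.encode f) (c : ℕ),
      ∀ k, M.time k ≤ c * (k + 1)

/-- Linear-time reducible to each other. -/
def LinearTimeEquivalent (A B : DecisionProblem Γ) : Prop :=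
  LinearTimeReducible A B ∧ LinearTimeReducible B A

end DecisionProblem

/-- Network equivalence: do two given `F`-networks compute the same function? -/
def NE (F : Set (ℝ → ℝ)) (code : F → List Bool) : DecisionProblem Sym where
  Inst := Network F × Network F
  encode I := encodeNetwork code I.1 ∅ ++ Sym.next :: encodeNetwork code I.2 ∅
  yes I := I.1.SameFunction I.2

/-- Is a given set `Y` of hidden nodes of a given `F`-network `N` necessary, that is, does the
deletion of `Y` change the computed function? -/
def NECE (F : Set (ℝ → ℝ)) (code : F → List Bool) : DecisionProblem Sym where
  Inst := NECEInstance F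
  encode I := encodeNetwork code I.N I.Y
  yes I := ¬ I.N.SameFunction (I.N.delete I.Y)

/-- `NE` for pairs of networks that have the same number of layers and in which all edges run
between consecutive layers. -/
def strictNE (F : Set (ℝ → ℝ)) (code : F → List Bool) : DecisionProblem Sym :=
  (NE F code).restrict fun I =>
    I.1.IsStrict ∧ I.2.IsStrict ∧ I.1.hidden.length = I.2.hidden.length

/-- `NECE` for networks in which all edges run between consecutive layers. -/
def strictNECE (F : Set (ℝ → ℝ)) (code : F → List Bool) : DecisionProblem Sym :=
  (NECE F code).restrict fun I => I.N.IsStrict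

end NeuralNet

end

/-! The complement of NECE reduces to NE by pairing `N` with a network that computes the same
function as `N ∖ Y`. Deleting `Y` literally is not a local operation on words: an edge leaving `Y`
carries no mark and could only be found by comparing names. So the nodes of `Y` are silenced
instead: each keeps its name and its outgoing edges, but becomes an identity node with bias 0 and no
incoming edges. It contributes 0 wherever it is read, exactly as a missing node does
(`Network.outputs_delete`). Layers and strictness are untouched.

Conversely, two networks of equal dimensions agree iff their difference vanishes. `diffNetwork`
contains a copy of each, a first layer of relay nodes that hand the common input to both copies, and
one output node per coordinate that subtracts. The marked set `diffSet` consists of the former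
output nodes. Once it is deleted, the new output nodes have no edges left and compute 0
(`outputs_diffNetwork_delete`), so `diffSet` is unnecessary iff the difference is 0
(`diffNetwork_sameFunction_iff`). Names are made disjoint by two-bit prefixes, which is again a
local rewriting, and the relays carry the prefixed names of the old input nodes, so that no edge has
to be redirected. The layers are merged backwards from the outputs: the two output layers then
coincide whatever the depths, and for equal depths all edges stay between consecutive layers. Pairs
of different dimensions go to the fixed instance `oneNetwork`, whose marked node is necessary.

Both maps are carried out by explicit stack machines. Correctness is a statement about `Reaches`,
without counting steps. The time bound comes from a potential, a weighted sum of stack heights plus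
a weight of the state, which drops at every step (`silenceMachine_decreasing`,
`diffMachine_decreasing`); the number of steps is at most the initial potential, which is linear in
the input length (`StackMachine.exists_computableInTime`). Reading onto a stack reverses a word and
moving it to the target reverses it back, so the machines write their results from the end to the
beginning. -/

/-! ### Multi-stack machines and a potential bound for their running time. -/

/-- A machine with stacks indexed by `K` over the alphabet `Γ`. In state `q` it pops the stack
`src q`; depending on the popped symbol (`none` for an empty stack) it pushes the symbols listed by
`out` and goes to the state given by `next`, or halts. -/
structure StackMachine (K Q Γ : Type) where
  src : Q → K
  next : Q → Option Γ → Option Q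
  out : Q → Option Γ → List (K × Γ)

namespace StackMachine

open Function Turing

variable {K Q Γ : Type} [DecidableEq K]

/-- Perform the pushes in a list, one after the other. -/
def pushAll (S : K → List Γ) : List (K × Γ) → K → List Γ
  | [] => S
  | p :: ps => pushAll (update S p.1 (p.2 :: S p.1)) ps

/-- The symbols that a list of pushes sends to the stack `k`. -/
def proj (k : K) (ps : List (K × Γ)) : List Γ :=
  ps.filterMap fun p => if p.1 = k then some p.2 else none

@[simp] theorem proj_nil (k : K) : proj k ([] : List (K × Γ)) = [] := rfl

@[simp] theorem proj_cons (k : K) (p : K × Γ) (ps : List (K × Γ)) :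
    proj k (p :: ps) = if p.1 = k then p.2 :: proj k ps else proj k ps := by
  unfold proj
  by_cases h : p.1 = k <;> simp [h]

@[simp] theorem proj_append (k : K) (ps qs : List (K × Γ)) :
    proj k (ps ++ qs) = proj k ps ++ proj k qs := by
  simp [proj]

theorem proj_flatMap {α : Type*} (k : K) (l : List α) (f : α → List (K × Γ)) :
    proj k (l.flatMap f) = l.flatMap fun a => proj k (f a) := by
  induction l with
  | nil => rfl
  | cons a l ih => simp [ih]

/-- The last push ends on top, hence the reversal. Thanks to this formula, the contents of the
stacks after a long run are found by computing `proj` of the list of pushes. -/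
theorem pushAll_apply (S : K → List Γ) (ps : List (K × Γ)) (k : K) :
    pushAll S ps k = (proj k ps).reverse ++ S k := by
  induction ps generalizing S with
  | nil => simp [pushAll]
  | cons p ps ih =>
    rw [pushAll, ih]
    by_cases h : p.1 = k
    · subst h; simp
    · simp [h, update_of_ne (Ne.symm h)]

theorem pushAll_append (S : K → List Γ) (ps qs : List (K × Γ)) :
    pushAll S (ps ++ qs) = pushAll (pushAll S ps) qs := by
  induction ps generalizing S with
  | nil => rfl
  | cons p ps ih => exact ih _

/-- The configuration in which only the stack `k` is nonempty. -/
def single (k : K) (w : List Γ) : K → List Γ := fun k' => if k' = k then w else []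

variable (M : StackMachine K Q Γ)

/-- The effect of one step from state `q`. -/
def step (q : Q) (S : K → List Γ) : Option Q × (K → List Γ) :=
  (M.next q (S (M.src q)).head?,
    pushAll (update S (M.src q) (S (M.src q)).tail) (M.out q (S (M.src q)).head?))

/-- One configuration leads to another in one step. -/
def Step (c c' : Option Q × (K → List Γ)) : Prop :=
  ∃ q, c.1 = some q ∧ c' = M.step q c.2

/-- One configuration leads to another. -/
def Reaches : Option Q × (K → List Γ) → Option Q × (K → List Γ) → Prop :=
  Relation.ReflTransGen M.Step

variable {M}

theorem Reaches.refl (c : Option Q × (K → List Γ)) : M.Reaches c c :=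
  Relation.ReflTransGen.refl

theorem Reaches.of_eq {q : Option Q} {S S' : K → List Γ} (h : S = S') :
    M.Reaches (q, S) (q, S') := h ▸ Reaches.refl _

theorem Reaches.trans {a b c : Option Q × (K → List Γ)} (h : M.Reaches a b)
    (h' : M.Reaches b c) : M.Reaches a c :=
  Relation.ReflTransGen.trans h h'

/-- A step that pops a symbol. -/
theorem Reaches.pop {q : Q} {S : K → List Γ} {a : Γ} {w : List Γ}
    {c : Option Q × (K → List Γ)} (hS : S (M.src q) = a :: w)
    (h : M.Reaches (M.next q (some a), pushAll (update S (M.src q) w) (M.out q (some a))) c) :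
    M.Reaches (some q, S) c := by
  refine Relation.ReflTransGen.head ⟨q, rfl, ?_⟩ h
  simp [step, hS]

/-- A step that finds its stack empty. -/
theorem Reaches.empty {q : Q} {S : K → List Γ} {c : Option Q × (K → List Γ)}
    (hS : S (M.src q) = [])
    (h : M.Reaches (M.next q none, pushAll S (M.out q none)) c) :
    M.Reaches (some q, S) c := by
  refine Relation.ReflTransGen.head ⟨q, rfl, ?_⟩ h
  simp only [step, hS, List.head?_nil, List.tail_nil]
  rw [← hS, update_eq_self]

/-- A loop that moves a word from its stack to another one. -/
theorem Reaches.move {q : Q} {k : K} (hk : k ≠ M.src q) :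
    ∀ (w v : List Γ) (S : K → List Γ) (c : Option Q × (K → List Γ)),
      (∀ a ∈ w, M.next q (some a) = some q) → (∀ a ∈ w, M.out q (some a) = [(k, a)]) →
      S (M.src q) = w ++ v →
      M.Reaches (some q, update (update S (M.src q) v) k (w.reverse ++ S k)) c →
      M.Reaches (some q, S) c
  | [], v, S, c, _, _, hS, h => by
      have : update (update S (M.src q) v) k (([] : List Γ).reverse ++ S k) = S := by
        rw [← show S (M.src q) = v from hS, update_eq_self]
        simp
      rwa [this] at h
  | a :: w, v, S, c, hn, ho, hS, h => by
      refine Reaches.pop (a := a) (w := w ++ v) hS ?_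
      rw [hn a (by simp), ho a (by simp)]
      refine Reaches.move hk w v _ c (fun b hb => hn b (by simp [hb]))
        (fun b hb => ho b (by simp [hb])) ?_ ?_
      · simp [pushAll, update_of_ne hk.symm]
      · convert h using 2
        funext k'
        by_cases h1 : k' = k
        · subst h1; simp [pushAll, update_of_ne hk]
        · by_cases h2 : k' = M.src q
          · subst h2; simp [pushAll, h1]
          · simp [pushAll, h1, h2]

/-! ### Reading a word -/

variable (M) in
/-- From state `q`, the machine reads the word `w` from the stack `k`, which it does not push to;
it ends in state `q'` and has performed the pushes `ps` meanwhile. -/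
def Reads (k : K) (q : Q) (w : List Γ) (q' : Q) (ps : List (K × Γ)) : Prop :=
  proj k ps = [] ∧ ∀ (S : K → List Γ) (v : List Γ), S k = w ++ v →
    M.Reaches (some q, S) (some q', pushAll (update S k v) ps)

/-- Pushes that avoid a stack commute with replacing its contents. This is what makes two readings
composable: the first leaves the unread rest of the input intact. -/
theorem pushAll_update {k : K} (S : K → List Γ) (v : List Γ) (ps : List (K × Γ))
    (h : proj k ps = []) : pushAll (update S k v) ps = update (pushAll S ps) k v := by
  funext k'
  by_cases hk : k' = k
  · subst hk; simp [pushAll_apply, h]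
  · simp [pushAll_apply, hk]

theorem Reads.nil (k : K) (q : Q) : M.Reads k q [] q [] :=
  ⟨rfl, fun S v h => by
    rw [← show S k = v from h, update_eq_self]
    exact Reaches.refl _⟩

theorem Reads.congr {k : K} {q q' : Q} {w w' : List Γ} {ps ps' : List (K × Γ)}
    (h : M.Reads k q w q' ps) (hw : w = w') (hps : ps = ps') : M.Reads k q w' q' ps' :=
  hw ▸ hps ▸ h

theorem Reads.append {k : K} {q q' q'' : Q} {w w' : List Γ} {ps ps' : List (K × Γ)}
    (h : M.Reads k q w q' ps) (h' : M.Reads k q' w' q'' ps') :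
    M.Reads k q (w ++ w') q'' (ps ++ ps') := by
  refine ⟨by rw [proj_append, h.1, h'.1, List.append_nil], fun S v hS => ?_⟩
  refine (h.2 S (w' ++ v) (by rw [hS, List.append_assoc])).trans ?_
  have := h'.2 (pushAll (update S k (w' ++ v)) ps) v (by
    rw [pushAll_update _ _ _ h.1, update_self])
  rwa [pushAll_update _ _ ps h.1, update_idem, ← pushAll_update S v ps h.1,
    ← pushAll_append, ← pushAll_update S _ ps h.1] at this

theorem Reads.singleton {k : K} {q q' : Q} {a : Γ} (hk : M.src q = k)
    (hn : M.next q (some a) = some q') (hp : proj k (M.out q (some a)) = []) :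
    M.Reads k q [a] q' (M.out q (some a)) := by
  subst hk
  refine ⟨hp, fun S v hS => Reaches.pop hS ?_⟩
  rw [hn]
  exact Reaches.refl _

theorem Reads.cons {k : K} {q q' q'' : Q} {a : Γ} {w : List Γ} {ps : List (K × Γ)}
    (hk : M.src q = k) (hn : M.next q (some a) = some q')
    (hp : proj k (M.out q (some a)) = []) (h : M.Reads k q' w q'' ps) :
    M.Reads k q (a :: w) q'' (M.out q (some a) ++ ps) :=
  (Reads.singleton hk hn hp).append h

theorem Reads.loop {k : K} {q : Q} (hk : M.src q = k) (f : Γ → List (K × Γ)) (w : List Γ)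
    (hn : ∀ a ∈ w, M.next q (some a) = some q) (ho : ∀ a ∈ w, M.out q (some a) = f a)
    (hp : ∀ a ∈ w, proj k (f a) = []) : M.Reads k q w q (w.flatMap f) := by
  induction w with
  | nil => exact Reads.nil k q
  | cons a w ih =>
    rw [List.flatMap_cons, ← ho a (by simp)]
    exact Reads.cons hk (hn a (by simp)) (by rw [ho a (by simp)]; exact hp a (by simp))
      (ih (fun b hb => hn b (by simp [hb])) (fun b hb => ho b (by simp [hb]))
        fun b hb => hp b (by simp [hb]))

/-- The state between blocks is only required to satisfy an invariant `p`, because the end of a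
block may be noticed only at the first symbol of the next one; the state left behind then depends on
the block. -/
theorem Reads.flatMap {k : K} {α : Type*} (p : Q → Prop) (enc : α → List Γ)
    (g : α → List (K × Γ)) (l : List α)
    (h : ∀ x ∈ l, ∀ q, p q → ∃ q', p q' ∧ M.Reads k q (enc x) q' (g x)) (q : Q) (hq : p q) :
    ∃ q', p q' ∧ M.Reads k q (l.flatMap enc) q' (l.flatMap g) := by
  induction l generalizing q with
  | nil => exact ⟨q, hq, Reads.nil k q⟩
  | cons a l ih =>
    obtain ⟨q', hq', h1⟩ := h a (by simp) q hq
    obtain ⟨q'', hq'', h2⟩ := ih (fun x hx => h x (by simp [hx])) q' hq'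
    exact ⟨q'', hq'', h1.append h2⟩

/-! ### Running time -/

section Potential

variable [Fintype K] (M) (w : K → ℕ) (wq : Q → ℕ)

/-- The potential of the stacks. -/
def stackPot (S : K → List Γ) : ℕ := ∑ k, w k * (S k).length

theorem stackPot_push (S : K → List Γ) (k : K) (a : Γ) :
    stackPot w (update S k (a :: S k)) = stackPot w S + w k := by
  unfold stackPot
  rw [← Finset.add_sum_erase _ _ (Finset.mem_univ k),
    ← Finset.add_sum_erase (a := k) _ (fun k => w k * (S k).length) (Finset.mem_univ k)]
  rw [Finset.sum_congr rfl (g := fun k => w k * (S k).length)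
    (fun x hx => by rw [update_of_ne (Finset.ne_of_mem_erase hx)])]
  simp only [update_self, List.length_cons]
  ring

/-- Popping an empty stack changes nothing and releases no potential, hence the case distinction. -/
theorem stackPot_pop (S : K → List Γ) (k : K) :
    stackPot w (update S k (S k).tail) + (if (S k).head?.isSome then w k else 0) =
      stackPot w S := by
  rcases h : S k with _ | ⟨a, v⟩
  · simp only [List.tail_nil, List.head?_nil, Option.isSome_none, Bool.false_eq_true, if_false,
      add_zero]
    rw [← h, update_eq_self]
  · have := stackPot_push w (update S k v) k a
    simp only [update_self, update_idem] at this
    rw [← h, update_eq_self] at this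
    simp [this]

theorem stackPot_pushAll (S : K → List Γ) (ps : List (K × Γ)) :
    stackPot w (pushAll S ps) = stackPot w S + (ps.map fun p => w p.1).sum := by
  induction ps generalizing S with
  | nil => rfl
  | cons p ps ih => rw [pushAll, ih, stackPot_push, List.map_cons, List.sum_cons, add_assoc]

theorem stackPot_single (k : K) (v : List Γ) : stackPot w (single k v) = w k * v.length := by
  unfold stackPot single
  rw [Finset.sum_eq_single k] <;> simp +contextual

/-- The potential of an optional state. -/
def statePot : Option Q → ℕ
  | none => 0
  | some q => wq q

/-- Every step lowers the potential. -/
def Decreasing : Prop :=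
  ∀ q a, statePot wq (M.next q a) + ((M.out q a).map fun p => w p.1).sum + 1 ≤
    wq q + if a.isSome then w (M.src q) else 0

end Potential

/-! ### Translation to `Turing.FinTM2` -/

variable (M)

/-- The statement that performs a list of pushes. -/
def pushStmt : List (K × Γ) → TM2.Stmt (fun _ : K => Γ) Q (Option Γ) →
    TM2.Stmt (fun _ : K => Γ) Q (Option Γ)
  | [], s => s
  | p :: ps, s => .push p.1 (fun _ => p.2) (pushStmt ps s)

/-- The statement that branches over the popped symbol. -/
def dispatch [DecidableEq Γ] (f : Option Γ → TM2.Stmt (fun _ : K => Γ) Q (Option Γ)) :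
    List (Option Γ) → TM2.Stmt (fun _ : K => Γ) Q (Option Γ)
  | [] => .halt
  | a :: l => .branch (fun v => decide (v = a)) (f a) (dispatch f l)

/-- The statement that enters an optional state. -/
def enter : Option Q → TM2.Stmt (fun _ : K => Γ) Q (Option Γ)
  | none => .load (fun _ => none) .halt
  | some q => .load (fun _ => none) (.goto fun _ => q)

theorem stepAux_pushStmt (ps : List (K × Γ)) (s : TM2.Stmt (fun _ : K => Γ) Q (Option Γ))
    (v : Option Γ) (S : K → List Γ) :
    TM2.stepAux (pushStmt ps s) v S = TM2.stepAux s v (pushAll S ps) := by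
  induction ps generalizing S with
  | nil => rfl
  | cons p ps ih => exact ih _

theorem stepAux_dispatch [DecidableEq Γ] (f : Option Γ → TM2.Stmt (fun _ : K => Γ) Q (Option Γ))
    (l : List (Option Γ)) (a : Option Γ) (ha : a ∈ l) (S : K → List Γ) :
    TM2.stepAux (dispatch f l) a S = TM2.stepAux (f a) a S := by
  induction l with
  | nil => simp at ha
  | cons b l ih =>
    by_cases h : a = b
    · simp [dispatch, h]
    · simp [dispatch, h, ih ((List.mem_cons.1 ha).resolve_left h)]

/-- `enter` clears the internal store, so that all configurations between two steps carry `none`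
there, as the initial and the halting configuration must. -/
theorem stepAux_enter (q : Option Q) (v : Option Γ) (S : K → List Γ) :
    TM2.stepAux (enter q : TM2.Stmt (fun _ : K => Γ) Q (Option Γ)) v S = ⟨q, none, S⟩ := by
  cases q <;> rfl

variable [Fintype Γ] [DecidableEq Γ]

/-- The statement of a state. -/
noncomputable def stmt (q : Q) : TM2.Stmt (fun _ : K => Γ) Q (Option Γ) :=
  .pop (M.src q) (fun _ a => a)
    (dispatch (fun a => pushStmt (M.out q a) (enter (M.next q a))) Finset.univ.toList)

theorem stepAux_stmt (q : Q) (v : Option Γ) (S : K → List Γ) :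
    TM2.stepAux (M.stmt q) v S = ⟨(M.step q S).1, none, (M.step q S).2⟩ := by
  rw [stmt, TM2.stepAux, stepAux_dispatch _ _ _ (by simp), stepAux_pushStmt, stepAux_enter]
  rfl

variable [Fintype K] [Fintype Q]

/-- The machine as a `Turing.FinTM2`. -/
noncomputable def toFinTM2 (q₀ : Q) (kin kout : K) : FinTM2 where
  K := K
  k₀ := kin
  k₁ := kout
  Γ _ := Γ
  Λ := Q
  main := q₀
  σ := Option Γ
  initialState := none
  m := M.stmt

theorem toFinTM2_step (q₀ : Q) (kin kout : K) (q : Q) (S : K → List Γ) :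
    (M.toFinTM2 q₀ kin kout).step (⟨some q, none, S⟩ : TM2.Cfg (fun _ : K => Γ) Q (Option Γ)) =
      some (⟨(M.step q S).1, none, (M.step q S).2⟩ :
        TM2.Cfg (fun _ : K => Γ) Q (Option Γ)) :=
  congrArg some (M.stepAux_stmt q none S)

theorem initList_toFinTM2 (q₀ : Q) (kin kout : K) (v : List Γ) :
    initList (M.toFinTM2 q₀ kin kout) v =
      (⟨some q₀, none, single kin v⟩ : TM2.Cfg (fun _ : K => Γ) Q (Option Γ)) := by
  refine congrArg (TM2.Cfg.mk (Γ := fun _ : K => Γ) (some q₀) none) (funext fun k : K => ?_)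
  by_cases h : k = kin
  · subst h
    exact (dif_pos rfl).trans (if_pos rfl).symm
  · exact (dif_neg h).trans (if_neg h).symm

theorem haltList_toFinTM2 (q₀ : Q) (kin kout : K) (v : List Γ) :
    haltList (M.toFinTM2 q₀ kin kout) v =
      (⟨none, none, single kout v⟩ : TM2.Cfg (fun _ : K => Γ) Q (Option Γ)) := by
  refine congrArg (TM2.Cfg.mk (Γ := fun _ : K => Γ) none none) (funext fun k : K => ?_)
  by_cases h : k = kout
  · subst h
    exact (dif_pos rfl).trans (if_pos rfl).symm
  · exact (dif_neg h).trans (if_neg h).symm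

/-- The final potential is kept on the left of the inequality so that the drops of the single steps
telescope in the induction. -/
theorem exists_steps {w : K → ℕ} {wq : Q → ℕ} (hM : M.Decreasing w wq) (q₀ : Q) (kin kout : K)
    {c c' : Option Q × (K → List Γ)} (h : M.Reaches c c') :
    ∃ n, n + (statePot wq c'.1 + stackPot w c'.2) ≤ statePot wq c.1 + stackPot w c.2 ∧
      (flip bind (M.toFinTM2 q₀ kin kout).step)^[n]
        (some (⟨c.1, none, c.2⟩ : TM2.Cfg (fun _ : K => Γ) Q (Option Γ))) =
        some (⟨c'.1, none, c'.2⟩ : TM2.Cfg (fun _ : K => Γ) Q (Option Γ)) := by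
  induction h using Relation.ReflTransGen.head_induction_on with
  | refl => exact ⟨0, by simp, rfl⟩
  | @head a _ h _ ih =>
    obtain ⟨n, hn, hi⟩ := ih
    obtain ⟨q, hq, rfl⟩ := h
    obtain ⟨aq, S⟩ := a
    obtain rfl : aq = some q := hq
    refine ⟨n + 1, ?_, ?_⟩
    · have h1 := hM q (S (M.src q)).head?
      have h2 := stackPot_pop w S (M.src q)
      simp only [step, stackPot_pushAll] at hn
      simp only [statePot] at h1 ⊢
      simp only [statePot] at hn
      omega
    · rw [iterate_succ_apply]
      refine Eq.trans ?_ hi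
      congr 1
      exact M.toFinTM2_step q₀ kin kout q S

/-- A stack machine that computes `f` and lowers a linear potential does so in linear time. -/
theorem exists_computableInTime {w : K → ℕ} {wq : Q → ℕ} (hM : M.Decreasing w wq)
    (q₀ : Q) (kin kout : K) {α β : Type} (ea : α → List Γ) (eb : β → List Γ) (f : α → β)
    (h : ∀ a, M.Reaches (some q₀, single kin (ea a)) (none, single kout (eb (f a)))) :
    ∃ (T : TM2ComputableInTime ea eb f) (c : ℕ), ∀ k, T.time k ≤ c * (k + 1) := by
  -- The time bound is the initial potential: only the input stack is nonempty at the start.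
  refine ⟨⟨⟨M.toFinTM2 q₀ kin kout, Equiv.refl Γ, Equiv.refl Γ⟩,
    fun k => w kin * k + wq q₀, fun a => ?_⟩, w kin + wq q₀, fun k => ?_⟩
  · choose n hn hi using M.exists_steps hM q₀ kin kout (h a)
    refine ⟨⟨n, ?_⟩, ?_⟩
    · have e1 : (ea a).map (Equiv.refl Γ).invFun = ea a := List.map_id _
      have e2 : (eb (f a)).map (Equiv.refl Γ).invFun = eb (f a) := List.map_id _
      have := initList_toFinTM2 M q₀ kin kout (ea a)
      have h2 := haltList_toFinTM2 M q₀ kin kout (eb (f a))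
      rw [← this, ← h2] at hi
      refine Eq.trans ?_ (hi.trans ?_)
      · exact congrArg _ (congrArg some (congrArg (initList _) e1))
      · exact (congrArg some (congrArg (haltList _) e2)).symm
    · simp only [stackPot_single, statePot] at hn
      change n ≤ w kin * (ea a).length + wq q₀
      omega
  · change w kin * k + wq q₀ ≤ _
    nlinarith [Nat.zero_le (wq q₀ * k), Nat.zero_le (w kin)]

end StackMachine

/-! ### Silencing nodes computes the same function as deleting them. -/

namespace NeuralNet

variable {F : Set (ℝ → ℝ)}

/-! ### Semantics -/

/-- The values of the input nodes named by a list, for input values given by a sequence. -/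
noncomputable def inputVal (ins : List NodeName) (x : ℕ → ℝ) : NodeName → ℝ := fun s =>
  if s ∈ ins then x (ins.idxOf s) else 0

theorem inputVal_of_not_mem {ins : List NodeName} {s : NodeName} (h : s ∉ ins) (x : ℕ → ℝ) :
    inputVal ins x s = 0 := if_neg h

/-- The list of output values for input values given by a sequence. -/
noncomputable def Network.outputs (N : Network F) (x : ℕ → ℝ) : List ℝ :=
  N.output.map fun v => v.value (N.hidden.foldl runLayer (inputVal N.inputs x))

theorem Network.inputValues_eq (N : Network F) (x : ℕ → ℝ) :
    N.inputValues (fun i => x i) = inputVal N.inputs x := by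
  funext s
  unfold Network.inputValues inputVal
  split_ifs <;> rfl

theorem Network.length_outputs (N : Network F) (x : ℕ → ℝ) : (N.outputs x).length = N.outDim := by
  simp [outputs, outDim]

theorem Network.compute_eq (N : Network F) (x : ℕ → ℝ) (i : Fin N.outDim) :
    N.compute (fun i => x i) i = (N.outputs x)[i.1]'(by rw [N.length_outputs]; exact i.2) := by
  simp only [Network.compute, Network.hiddenValues, N.inputValues_eq, outputs, List.getElem_map]
  rfl

/-- Sequences as inputs and lists as outputs remove the casts between `Fin` types. Every input
vector extends to a sequence by zeros, and equality of the output lists contains equality of the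
output dimensions. -/
theorem Network.sameFunction_iff (N M : Network F) :
    N.SameFunction M ↔ N.inputs.length = M.inputs.length ∧ ∀ x, N.outputs x = M.outputs x := by
  constructor
  · rintro ⟨hn, hm, h⟩
    refine ⟨hn.symm, fun x => List.ext_getElem ?_ fun i h1 h2 => ?_⟩
    · rw [length_outputs, length_outputs, hm]
    · have hi : i < N.outDim := N.length_outputs x ▸ h1
      have := h (fun i => x i) ⟨i, hi⟩
      rw [N.compute_eq] at this
      exact this.trans (M.compute_eq x _)
  · rintro ⟨hn, h⟩
    have hn' : M.inDim = N.inDim := hn.symm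
    have hm : N.outDim = M.outDim := by
      rw [← N.length_outputs 0, ← M.length_outputs 0, h]
    refine ⟨hn', hm, fun x i => ?_⟩
    obtain ⟨y, rfl⟩ : ∃ y : ℕ → ℝ, x = fun j : Fin N.inDim => y j.1 :=
      ⟨fun j => if hj : j < N.inDim then x ⟨j, hj⟩ else 0, by funext j; simp⟩
    rw [N.compute_eq]
    refine Eq.trans ?_ (M.compute_eq y (Fin.cast hm i)).symm
    simp only [h y, Fin.val_cast]

theorem runLayer_cons (val : NodeName → ℝ) (v : Node F) (l : List (Node F)) (s : NodeName) :
    runLayer val (v :: l) s = if v.name = s then v.value val else runLayer val l s := by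
  by_cases h : v.name = s <;> simp [runLayer, h]

theorem runLayer_append (val : NodeName → ℝ) (l l' : List (Node F)) (s : NodeName) :
    runLayer val (l ++ l') s =
      if s ∈ layerNames l then runLayer val l s else runLayer val l' s := by
  induction l with
  | nil => simp [layerNames]
  | cons v l ih =>
    rw [List.cons_append, runLayer_cons, ih, runLayer_cons]
    by_cases h : v.name = s
    · simp [h, layerNames]
    · simp [h, Ne.symm h, layerNames]

theorem runLayer_of_not_mem (val : NodeName → ℝ) (l : List (Node F)) (s : NodeName)
    (h : s ∉ layerNames l) : runLayer val l s = val s := by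
  induction l with
  | nil => rfl
  | cons v l ih =>
    simp only [layerNames, List.map_cons, List.mem_cons, not_or] at h
    rw [runLayer_cons, if_neg (Ne.symm h.1), ih h.2]

theorem Network.hiddenNames_nodup_append (N : Network F) :
    (N.inputs ++ (N.hiddenNames ++ layerNames N.output)).Nodup := by
  simpa [hiddenNames, List.flatMap_append] using N.names_nodup

/-! ### Silencing nodes -/

/-- The identity as an element of `F`. -/
def idAct (hid : (id : ℝ → ℝ) ∈ F) : F := ⟨id, hid⟩

/-- Replace a node in `Y` by a node that computes `0`. -/
def silence (hid : (id : ℝ → ℝ) ∈ F) (Y : Finset NodeName) (v : Node F) : Node F :=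
  if v.name ∈ Y then ⟨v.name, idAct hid, 0, []⟩ else v

variable (hid : (id : ℝ → ℝ) ∈ F) (Y : Finset NodeName)

@[simp] theorem silence_name (v : Node F) : (silence hid Y v).name = v.name := by
  unfold silence; split_ifs <;> rfl

theorem mem_edges_of_silence {v : Node F} {e : NodeName × ℚ}
    (h : e ∈ (silence hid Y v).edges) : e ∈ v.edges := by
  unfold silence at h; split_ifs at h
  · simp at h
  · exact h

@[simp] theorem layerNames_silence (l : List (Node F)) :
    layerNames (l.map (silence hid Y)) = layerNames l := by
  simp [layerNames, Function.comp_def]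

theorem feedsForward_silence (ls : List (List (Node F))) (a : List NodeName)
    (h : FeedsForward a ls) : FeedsForward a (ls.map (List.map (silence hid Y))) := by
  induction ls generalizing a with
  | nil => trivial
  | cons l ls ih =>
    refine ⟨?_, by rw [layerNames_silence]; exact ih _ h.2⟩
    intro v hv e he
    obtain ⟨u, hu, rfl⟩ := List.mem_map.1 hv
    exact h.1 u hu e (mem_edges_of_silence hid Y he)

theorem feedsConsecutively_silence (ls : List (List (Node F))) (a : List NodeName)
    (h : FeedsConsecutively a ls) :
    FeedsConsecutively a (ls.map (List.map (silence hid Y))) := by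
  induction ls generalizing a with
  | nil => trivial
  | cons l ls ih =>
    refine ⟨?_, by rw [layerNames_silence]; exact ih _ h.2⟩
    intro v hv e he
    obtain ⟨u, hu, rfl⟩ := List.mem_map.1 hv
    exact h.1 u hu e (mem_edges_of_silence hid Y he)

/-- The network in which the nodes in `Y` compute `0`. -/
def Network.silence (N : Network F) : Network F where
  inputs := N.inputs
  hidden := N.hidden.map (List.map (NeuralNet.silence hid Y))
  -- Output nodes are treated like hidden ones, which keeps the rewriting uniform; they are
  -- unchanged when `Y` consists of hidden nodes.
  output := N.output.map (NeuralNet.silence hid Y)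
  names_nodup := by
    simpa [List.flatMap_map, List.flatMap_append] using N.names_nodup
  edges_nodup := by
    intro l hl v hv
    have : ∃ l' ∈ N.hidden ++ [N.output], l'.map (NeuralNet.silence hid Y) = l := by
      simpa [eq_comm, or_comm] using hl
    obtain ⟨l', hl', rfl⟩ := this
    obtain ⟨u, hu, rfl⟩ := List.mem_map.1 hv
    unfold NeuralNet.silence
    split_ifs
    · simp
    · exact N.edges_nodup l' hl' u hu
  feedsForward := by
    simpa using feedsForward_silence hid Y _ _ N.feedsForward

theorem Network.isStrict_silence (N : Network F) (h : N.IsStrict) :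
    (N.silence hid Y).IsStrict := by
  have := feedsConsecutively_silence hid Y _ _ h
  simpa [Network.IsStrict, Network.silence] using this

/-- Values that vanish on `Y` and agree with other values elsewhere. -/
def AgreeOff (val val' : NodeName → ℝ) : Prop :=
  (∀ s, s ∉ Y → val s = val' s) ∧ ∀ s ∈ Y, val' s = 0

variable {Y} in
-- An edge from `Y` contributes a weight times 0 on the right and is absent on the left. Hence `val`
-- may be arbitrary on `Y`: these values are never read.
theorem AgreeOff.value_dropEdges {val val' : NodeName → ℝ} (h : AgreeOff Y val val')
    (v : Node F) : (v.dropEdges Y).value val = v.value val' := by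
  unfold Node.value Node.dropEdges
  refine congrArg v.act.1 (congrArg (· + (v.bias : ℝ)) ?_)
  dsimp only
  induction v.edges with
  | nil => rfl
  | cons e es ih =>
    by_cases he : e.1 ∈ Y
    · simpa [he, h.2 _ he] using ih
    · simpa [he, h.1 _ he] using ih

variable {Y} in
theorem AgreeOff.runLayer {val val' : NodeName → ℝ} (h : AgreeOff Y val val')
    (l : List (Node F)) :
    AgreeOff Y (runLayer val (dropNodes Y l)) (runLayer val' (l.map (silence hid Y))) := by
  induction l with
  | nil => exact h
  | cons v l ih =>
    by_cases hv : v.name ∈ Y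
    · have e : dropNodes Y (v :: l) = dropNodes Y l := by simp [dropNodes, hv]
      refine ⟨fun s hs => ?_, fun s hs => ?_⟩
      · rw [e, ih.1 s hs, List.map_cons, runLayer_cons, silence_name, if_neg]
        rintro rfl
        exact hs hv
      · rw [List.map_cons, runLayer_cons, silence_name]
        split_ifs with hvs
        · simp [silence, hv, Node.value, idAct]
        · exact ih.2 s hs
    · have e : dropNodes Y (v :: l) = v.dropEdges Y :: dropNodes Y l := by
        simp [dropNodes, hv]
      refine ⟨fun s hs => ?_, fun s hs => ?_⟩
      · rw [e, List.map_cons, runLayer_cons, runLayer_cons, silence_name, ih.1 s hs,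
          show (v.dropEdges Y).name = v.name from rfl, h.value_dropEdges]
        simp [silence, hv]
      · rw [List.map_cons, runLayer_cons, silence_name, if_neg, ih.2 s hs]
        rintro rfl
        exact hv hs

theorem AgreeOff.foldl_runLayer (ls : List (List (Node F))) {val val' : NodeName → ℝ}
    (h : AgreeOff Y val val') :
    AgreeOff Y ((ls.map (dropNodes Y)).foldl NeuralNet.runLayer val)
      ((ls.map (List.map (silence hid Y))).foldl NeuralNet.runLayer val') := by
  induction ls generalizing val val' with
  | nil => exact h
  | cons l ls ih => exact ih (h.runLayer hid l)

variable {Y} in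
theorem Network.not_mem_inputs_of_hidden {N : Network F} {s : NodeName}
    (h : s ∈ N.hiddenNames) : s ∉ N.inputs := fun h' =>
  List.disjoint_of_nodup_append N.hiddenNames_nodup_append h' (List.mem_append_left _ h)

theorem Network.not_mem_output_of_hidden {N : Network F} {s : NodeName}
    (h : s ∈ N.hiddenNames) : s ∉ layerNames N.output := fun h' =>
  List.disjoint_of_nodup_append (List.Nodup.of_append_right N.hiddenNames_nodup_append) h h'

/-- That `Y` is hidden enters twice: no name in `Y` is an input, so the initial values on `Y` are
the default 0, and no output node is silenced. -/
theorem Network.outputs_delete (N : Network F) (hY : ∀ s ∈ Y, s ∈ N.hiddenNames) (x : ℕ → ℝ) :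
    (N.delete Y).outputs x = (N.silence hid Y).outputs x := by
  have h0 : AgreeOff Y (inputVal N.inputs x) (inputVal N.inputs x) :=
    ⟨fun _ _ => rfl, fun s hs => inputVal_of_not_mem (not_mem_inputs_of_hidden (hY s hs)) x⟩
  have h := AgreeOff.foldl_runLayer hid Y N.hidden h0
  simp only [outputs, delete, silence, List.map_map]
  refine List.map_congr_left fun v hv => ?_
  have hvY : v.name ∉ Y := fun hc =>
    not_mem_output_of_hidden (hY _ hc) (List.mem_map_of_mem hv)
  simp [h.value_dropEdges, NeuralNet.silence, hvY]

theorem Network.sameFunction_delete_iff (N : Network F) (hY : ∀ s ∈ Y, s ∈ N.hiddenNames) :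
    N.SameFunction (N.delete Y) ↔ N.SameFunction (N.silence hid Y) := by
  rw [sameFunction_iff, sameFunction_iff]
  simp only [N.outputs_delete hid Y hY]
  rfl

end NeuralNet

/-! ### The difference network and its marked set. -/

namespace NeuralNet

variable {F : Set (ℝ → ℝ)}

/-! ### Merging two lists of layers -/

/-- Merge the lists of a list with those of another one, position by position. -/
def zipLayers {α : Type*} : List (List α) → List (List α) → List (List α)
  | [], bs => bs
  | a :: as, [] => a :: as
  | a :: as, b :: bs => (b ++ a) :: zipLayers as bs

theorem zipLayers_nil_right {α : Type*} (as : List (List α)) : zipLayers as [] = as := by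
  cases as <;> rfl

theorem mem_of_mem_zipLayers {α : Type*} {as bs : List (List α)} {l : List α} {v : α}
    (hl : l ∈ zipLayers as bs) (hv : v ∈ l) :
    (∃ l' ∈ as, v ∈ l') ∨ ∃ l' ∈ bs, v ∈ l' := by
  induction as, bs using zipLayers.induct with
  | case1 bs => exact Or.inr ⟨l, hl, hv⟩
  | case2 a as => exact Or.inl ⟨l, hl, hv⟩
  | case3 a as b bs ih =>
    rcases List.mem_cons.1 hl with rfl | hl
    · rcases List.mem_append.1 hv with hv | hv
      · exact Or.inr ⟨b, by simp, hv⟩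
      · exact Or.inl ⟨a, by simp, hv⟩
    · rcases ih hl with ⟨l', h, h'⟩ | ⟨l', h, h'⟩
      · exact Or.inl ⟨l', by simp [h], h'⟩
      · exact Or.inr ⟨l', by simp [h], h'⟩

theorem flatMap_zipLayers_perm {α β : Type*} (f : α → β) (as bs : List (List α)) :
    ((zipLayers as bs).flatMap (List.map f)).Perm
      (as.flatMap (List.map f) ++ bs.flatMap (List.map f)) := by
  induction as, bs using zipLayers.induct with
  | case1 bs => exact List.Perm.refl _
  | case2 a as => simp [zipLayers]
  | case3 a as b bs ih =>
    classical
    rw [List.perm_iff_count] at ih ⊢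
    intro s
    have := ih s
    simp only [zipLayers, List.flatMap_cons, List.map_append, List.count_append] at this ⊢
    omega

theorem mem_names_zipLayers {as bs : List (List (Node F))} {s : NodeName} :
    s ∈ (zipLayers as bs).flatMap layerNames ↔
      s ∈ as.flatMap layerNames ∨ s ∈ bs.flatMap layerNames := by
  rw [← List.mem_append]
  exact (flatMap_zipLayers_perm Node.name as bs).mem_iff

theorem feedsForward_append (ls ls' : List (List (Node F))) (a : List NodeName) :
    FeedsForward a (ls ++ ls') ↔
      FeedsForward a ls ∧ FeedsForward (a ++ ls.flatMap layerNames) ls' := by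
  induction ls generalizing a with
  | nil => simp [FeedsForward]
  | cons l ls ih => simp [FeedsForward, ih, and_assoc]

/-- The lists hold the last layer first, so the induction removes the last layer on both sides. A
node there reads names from earlier layers of its own list, all of which survive in the merge of the
rest. -/
theorem feedsForward_zipLayers (a : List NodeName) (as bs : List (List (Node F)))
    (ha : FeedsForward a as.reverse) (hb : FeedsForward a bs.reverse) :
    FeedsForward a (zipLayers as bs).reverse := by
  induction as, bs using zipLayers.induct with
  | case1 bs => exact hb
  | case2 l as => exact ha
  | case3 l as l' bs ih =>
    rw [List.reverse_cons, feedsForward_append] at ha hb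
    rw [zipLayers, List.reverse_cons, feedsForward_append]
    refine ⟨ih ha.1 hb.1, fun v hv e he => ?_, trivial⟩
    have key : e.1 ∈ a ∨ e.1 ∈ as.flatMap layerNames ∨ e.1 ∈ bs.flatMap layerNames := by
      rcases List.mem_append.1 hv with hv | hv
      · rcases List.mem_append.1 (hb.2.1 v hv e he) with h | h
        · exact Or.inl h
        · exact Or.inr (Or.inr (by simpa using h))
      · rcases List.mem_append.1 (ha.2.1 v hv e he) with h | h
        · exact Or.inl h
        · exact Or.inr (Or.inl (by simpa using h))
    rw [← mem_names_zipLayers] at key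
    simpa using key

/-- The names of the last layer of a list, where `a` precedes the first layer. -/
def lastNames (a : List NodeName) (ls : List (List (Node F))) : List NodeName :=
  (ls.getLast?.map layerNames).getD a

theorem feedsConsecutively_concat (ls : List (List (Node F))) (l : List (Node F))
    (a : List NodeName) :
    FeedsConsecutively a (ls ++ [l]) ↔
      FeedsConsecutively a ls ∧ ∀ v ∈ l, ∀ e ∈ v.edges, e.1 ∈ lastNames a ls := by
  induction ls generalizing a with
  | nil => simp [FeedsConsecutively, lastNames]
  | cons k ls ih =>
    have : lastNames a (k :: ls) = lastNames (layerNames k) ls := by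
      cases ls <;> simp [lastNames, List.getLast?_cons]
    rw [List.cons_append, FeedsConsecutively, FeedsConsecutively, ih, this, and_assoc]

/-- Equal lengths are essential: otherwise the first layer of the shorter list, which reads `a`,
would be preceded by a layer of the longer one. -/
theorem feedsConsecutively_zipLayers (a : List NodeName) (as bs : List (List (Node F)))
    (ha : FeedsConsecutively a as.reverse) (hb : FeedsConsecutively a bs.reverse)
    (h : as.length = bs.length) : FeedsConsecutively a (zipLayers as bs).reverse := by
  induction as, bs using zipLayers.induct with
  | case1 bs => exact hb
  | case2 l as => exact ha
  | case3 l as l' bs ih =>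
    rw [List.reverse_cons, feedsConsecutively_concat] at ha hb
    rw [zipLayers, List.reverse_cons, feedsConsecutively_concat]
    have h' : as.length = bs.length := by simpa using h
    refine ⟨ih ha.1 hb.1 h', fun v hv e he => ?_⟩
    have key : e.1 ∈ lastNames a as.reverse ∨ e.1 ∈ lastNames a bs.reverse :=
      (List.mem_append.1 hv).elim (fun hv => Or.inr (hb.2 v hv e he))
        fun hv => Or.inl (ha.2 v hv e he)
    -- By `h'` the remaining lists are both empty, so that `a` is read, or both nonempty, so that
    -- the merged layer `k' ++ k` is read.
    rcases as with _ | ⟨k, as⟩ <;> rcases bs with _ | ⟨k', bs⟩ <;>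
      simp_all [lastNames, zipLayers, layerNames, or_comm]

/-! ### Tagged networks -/

/-- The tag of the names of the nodes of the two networks of a pair. -/
def sideTag (b : Bool) : List Bool := [b, !b]

/-- The tag of the names of the common input nodes. -/
def inTag : List Bool := [false, false]

/-- The tag of the names of the output nodes that compute differences. -/
def outTag : List Bool := [true, true]

/-- Put a tag in front of the names in a node. -/
def tagNode (t : List Bool) (v : Node F) : Node F :=
  ⟨t ++ v.name, v.act, v.bias, v.edges.map fun e => (t ++ e.1, e.2)⟩

/-- Put a tag in front of the names in a list of layers. -/
def tagLayers (t : List Bool) (ls : List (List (Node F))) : List (List (Node F)) :=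
  ls.map (List.map (tagNode t))

theorem layerNames_tagNode (t : List Bool) (l : List (Node F)) :
    layerNames (l.map (tagNode t)) = (layerNames l).map (t ++ ·) := by
  simp [layerNames, tagNode]

theorem flatMap_layerNames_tagLayers (t : List Bool) (ls : List (List (Node F))) :
    (tagLayers t ls).flatMap layerNames = (ls.flatMap layerNames).map (t ++ ·) := by
  simp [tagLayers, List.flatMap_map, List.map_flatMap, layerNames_tagNode]

theorem tagLayers_reverse (t : List Bool) (ls : List (List (Node F))) :
    (tagLayers t ls).reverse = tagLayers t ls.reverse := by
  simp [tagLayers]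

theorem feedsForward_tagLayers (t : List Bool) (ls : List (List (Node F)))
    {a a' : List NodeName} (h : FeedsForward a ls) (ha : ∀ s ∈ a, t ++ s ∈ a') :
    FeedsForward a' (tagLayers t ls) := by
  induction ls generalizing a a' with
  | nil => trivial
  | cons l ls ih =>
    refine ⟨?_, ih h.2 ?_⟩
    · intro v hv e he
      obtain ⟨u, hu, rfl⟩ := List.mem_map.1 hv
      obtain ⟨d, hd, rfl⟩ := List.mem_map.1 he
      exact ha _ (h.1 u hu d hd)
    · intro s hs
      rw [layerNames_tagNode]
      rcases List.mem_append.1 hs with hs | hs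
      · exact List.mem_append_left _ (ha s hs)
      · exact List.mem_append_right _ (List.mem_map_of_mem hs)

theorem feedsConsecutively_tagLayers (t : List Bool) (ls : List (List (Node F)))
    {a a' : List NodeName} (h : FeedsConsecutively a ls) (ha : ∀ s ∈ a, t ++ s ∈ a') :
    FeedsConsecutively a' (tagLayers t ls) := by
  induction ls generalizing a a' with
  | nil => trivial
  | cons l ls ih =>
    refine ⟨?_, ih h.2 ?_⟩
    · intro v hv e he
      obtain ⟨u, hu, rfl⟩ := List.mem_map.1 hv
      obtain ⟨d, hd, rfl⟩ := List.mem_map.1 he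
      exact ha _ (h.1 u hu d hd)
    · intro s hs
      rw [layerNames_tagNode]
      exact List.mem_map_of_mem hs

/-! ### The difference of two networks -/

section Difference

variable (hid : (id : ℝ → ℝ) ∈ F) (P : Bool → Network F)

/-- A node of the network with tag `b` that copies the common input node with name `s`. -/
def relay (b : Bool) (u s : NodeName) : Node F :=
  ⟨sideTag b ++ u, idAct hid, 0, [(inTag ++ s, 1)]⟩

/-- The copies of a common input node. -/
def relays (p : NodeName × NodeName) : List (Node F) :=
  [relay hid false p.1 p.1, relay hid true p.2 p.1]

/-- The output node that computes the difference of two output nodes. -/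
def diffNode (p : NodeName × NodeName) : Node F :=
  ⟨outTag ++ p.1, idAct hid, 0, [(sideTag false ++ p.1, 1), (sideTag true ++ p.2, -1)]⟩

/-- The pairs of corresponding input nodes. -/
def inPairs : List (NodeName × NodeName) := (P false).inputs.zip (P true).inputs

/-- The pairs of corresponding output nodes. -/
def outPairs : List (NodeName × NodeName) :=
  (layerNames (P false).output).zip (layerNames (P true).output)

/-- The hidden layers and the output layer of a network, last layer first. -/
def revLayers (N : Network F) : List (List (Node F)) := N.output :: N.hidden.reverse

/-- The layers of two networks, merged and last layer first. -/
def mergedLayers : List (List (Node F)) :=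
  zipLayers (tagLayers (sideTag false) (revLayers (P false)))
    (tagLayers (sideTag true) (revLayers (P true)))

/-- The hidden layers of the difference of two networks. -/
def diffHidden : List (List (Node F)) :=
  (inPairs P).flatMap (relays hid) :: (mergedLayers P).reverse

theorem revLayers_reverse (N : Network F) : (revLayers N).reverse = N.hidden ++ [N.output] := by
  simp [revLayers]

/-- The two networks have the same dimensions. -/
def SameDims : Prop :=
  (P false).inputs.length = (P true).inputs.length ∧
    (P false).output.length = (P true).output.length

variable {P}

theorem inPairs_fst (h : SameDims P) : (inPairs P).map Prod.fst = (P false).inputs :=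
  List.map_fst_zip h.1.le

theorem inPairs_snd (h : SameDims P) : (inPairs P).map Prod.snd = (P true).inputs :=
  List.map_snd_zip h.1.ge

theorem outPairs_fst (h : SameDims P) :
    (outPairs P).map Prod.fst = layerNames (P false).output :=
  List.map_fst_zip (by simp [layerNames, h.2])

theorem outPairs_snd (h : SameDims P) :
    (outPairs P).map Prod.snd = layerNames (P true).output :=
  List.map_snd_zip (by simp [layerNames, h.2])

theorem layerNames_relays (l : List (NodeName × NodeName)) :
    (layerNames (l.flatMap (relays hid))).Perm
      ((l.map Prod.fst).map (sideTag false ++ ·) ++ (l.map Prod.snd).map (sideTag true ++ ·)) := by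
  induction l with
  | nil => exact List.Perm.refl _
  | cons p l ih =>
    rw [List.perm_iff_count] at ih ⊢
    intro s
    have := ih s
    simp only [layerNames, relays, relay, List.flatMap_cons, List.map_append, List.map_cons,
      List.map_nil, List.count_append, List.count_cons, List.count_nil] at this ⊢
    omega

theorem mem_layerNames_relays (h : SameDims P) (b : Bool) {s : NodeName}
    (hs : s ∈ (P b).inputs) :
    sideTag b ++ s ∈ layerNames ((inPairs P).flatMap (relays hid)) := by
  rw [(layerNames_relays hid _).mem_iff, inPairs_fst h, inPairs_snd h]
  cases b
  · exact List.mem_append_left _ (List.mem_map_of_mem hs)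
  · exact List.mem_append_right _ (List.mem_map_of_mem hs)

theorem mem_layerNames_outPairs {p : NodeName × NodeName} (hp : p ∈ outPairs P) :
    p.1 ∈ layerNames (P false).output ∧ p.2 ∈ layerNames (P true).output :=
  List.of_mem_zip hp

theorem mergedLayers_eq : mergedLayers P =
    ((P true).output.map (tagNode (sideTag true)) ++
      (P false).output.map (tagNode (sideTag false))) ::
      zipLayers (tagLayers (sideTag false) (P false).hidden.reverse)
        (tagLayers (sideTag true) (P true).hidden.reverse) := rfl

theorem mem_outputs_merged {p : NodeName × NodeName} (hp : p ∈ outPairs P) {e : NodeName × ℚ}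
    (he : e ∈ (diffNode hid p).edges) :
    e.1 ∈ layerNames ((P true).output.map (tagNode (sideTag true)) ++
      (P false).output.map (tagNode (sideTag false))) := by
  have h : layerNames ((P true).output.map (tagNode (sideTag true)) ++
      (P false).output.map (tagNode (sideTag false))) =
      (layerNames (P true).output).map (sideTag true ++ ·) ++
        (layerNames (P false).output).map (sideTag false ++ ·) := by
    rw [← layerNames_tagNode, ← layerNames_tagNode]
    simp [layerNames]
  obtain ⟨h1, h2⟩ := mem_layerNames_outPairs hp
  rw [h]
  simp only [diffNode, List.mem_cons, List.not_mem_nil, or_false] at he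
  rcases he with rfl | rfl
  · exact List.mem_append_right _ (List.mem_map_of_mem h1)
  · exact List.mem_append_left _ (List.mem_map_of_mem h2)

/-- Different prefixes of the same length cannot begin the same word. The four tags in use are the
four words of two bits. -/
theorem disjoint_map_tag {t t' : List Bool} (hl : t.length = t'.length) (h : t ≠ t')
    (l l' : List NodeName) : (l.map (t ++ ·)).Disjoint (l'.map (t' ++ ·)) := by
  intro s h1 h2
  obtain ⟨u, -, rfl⟩ := List.mem_map.1 h1
  obtain ⟨u', -, hu⟩ := List.mem_map.1 h2
  exact h (List.append_inj hu hl.symm).1.symm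

theorem diff_names_nodup (h : SameDims P) :
    ((P false).inputs.map (inTag ++ ·) ++
      (diffHidden hid P ++ [(outPairs P).map (diffNode hid)]).flatMap layerNames).Nodup := by
  let all : Bool → List NodeName := fun b =>
    (P b).inputs ++ ((P b).hidden ++ [(P b).output]).flatMap layerNames
  have hall : ∀ b, (all b).Nodup := fun b => (P b).names_nodup
  have inj : ∀ t : List Bool, Function.Injective (t ++ ·) := fun t => List.append_right_injective t
  -- Up to order, the names are four lists with four different tags. Since the relays take the
  -- tagged names of the inputs, each side contributes all names of its network.
  have hnd : (((P false).inputs.map (inTag ++ ·) ++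
      (layerNames (P false).output).map (outTag ++ ·)) ++
      ((all false).map (sideTag false ++ ·) ++ (all true).map (sideTag true ++ ·))).Nodup := by
    have hi : (P false).inputs.Nodup := (hall false).of_append_left
    have ho : (layerNames (P false).output).Nodup := by
      have := (hall false).of_append_right
      rw [List.flatMap_append] at this
      simpa using this.of_append_right
    refine List.Nodup.append (List.Nodup.append (hi.map (inj _)) (ho.map (inj _)) ?_)
      (List.Nodup.append ((hall _).map (inj _)) ((hall _).map (inj _)) ?_) ?_
    · refine disjoint_map_tag ?_ ?_ _ _ <;> simp [inTag, outTag]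
    · refine disjoint_map_tag ?_ ?_ _ _ <;> simp [sideTag]
    · simp only [List.disjoint_append_left, List.disjoint_append_right]
      refine ⟨⟨?_, ?_⟩, ?_, ?_⟩ <;> refine disjoint_map_tag ?_ ?_ _ _ <;> simp [inTag, outTag, sideTag]
  refine (List.Perm.nodup_iff ?_).1 hnd
  have hr := layerNames_relays hid (inPairs P)
  rw [inPairs_fst h, inPairs_snd h] at hr
  have hm := flatMap_zipLayers_perm Node.name
    (tagLayers (sideTag false) (revLayers (P false)))
    (tagLayers (sideTag true) (revLayers (P true)))
  have hm' : ((mergedLayers P).reverse.flatMap layerNames).Perm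
      ((((P false).hidden ++ [(P false).output]).flatMap layerNames).map (sideTag false ++ ·) ++
        (((P true).hidden ++ [(P true).output]).flatMap layerNames).map (sideTag true ++ ·)) := by
    refine ((List.reverse_perm _).flatMap_right _).trans (hm.trans (List.Perm.append ?_ ?_))
    all_goals
      rw [← revLayers_reverse, ← flatMap_layerNames_tagLayers, ← tagLayers_reverse]
      exact ((List.reverse_perm _).flatMap_right _).symm
  have hd : layerNames ((outPairs P).map (diffNode hid)) =
      (layerNames (P false).output).map (outTag ++ ·) := by
    rw [← outPairs_fst h]
    simp [layerNames, diffNode]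
  rw [List.perm_iff_count] at hr hm' ⊢
  intro s
  have h1 := hr s
  have h2 := hm' s
  simp only [all, diffHidden, List.flatMap_cons, List.cons_append, List.flatMap_append,
    List.map_append, List.flatMap_nil, List.count_append, hd, List.append_nil] at h1 h2 ⊢
  omega

theorem diff_edges_nodup : ∀ l ∈ diffHidden hid P ++ [(outPairs P).map (diffNode hid)],
    ∀ v ∈ l, (v.edges.map Prod.fst).Nodup := by
  have tagged : ∀ b, ∀ l ∈ tagLayers (sideTag b) (revLayers (P b)), ∀ v ∈ l,
      (v.edges.map Prod.fst).Nodup := by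
    intro b l hl v hv
    obtain ⟨l', hl', rfl⟩ := List.mem_map.1 hl
    obtain ⟨u, hu, rfl⟩ := List.mem_map.1 hv
    have hl'' : l' ∈ (P b).hidden ++ [(P b).output] := by
      rw [← revLayers_reverse]; simpa using hl'
    have := ((P b).edges_nodup l' hl'' u hu).map (List.append_right_injective (sideTag b))
    simpa [tagNode, Function.comp_def] using this
  intro l hl v hv
  rcases List.mem_append.1 hl with hl | hl
  · rcases List.mem_cons.1 hl with rfl | hl
    · obtain ⟨p, -, hp⟩ := List.mem_flatMap.1 hv
      simp only [relays, List.mem_cons, List.not_mem_nil, or_false] at hp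
      rcases hp with rfl | rfl <;> simp [relay]
    · rcases mem_of_mem_zipLayers (List.mem_reverse.1 hl) hv with ⟨l', h, h'⟩ | ⟨l', h, h'⟩
      · exact tagged _ _ h _ h'
      · exact tagged _ _ h _ h'
  · rw [List.mem_singleton] at hl
    subst hl
    obtain ⟨p, -, rfl⟩ := List.mem_map.1 hv
    simp [diffNode, sideTag]

theorem relays_edges {v : Node F} (hv : v ∈ (inPairs P).flatMap (relays hid))
    {e : NodeName × ℚ} (he : e ∈ v.edges) : e.1 ∈ (P false).inputs.map (inTag ++ ·) := by
  obtain ⟨p, hp, hv⟩ := List.mem_flatMap.1 hv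
  have h1 : p.1 ∈ (P false).inputs := (List.of_mem_zip hp).1
  simp only [relays, List.mem_cons, List.not_mem_nil, or_false] at hv
  rcases hv with rfl | rfl
  all_goals
    simp only [relay, List.mem_cons, List.not_mem_nil, or_false] at he
    subst he
    exact List.mem_map_of_mem h1

/-- The relay layer supplies the tagged input names that both copies read, and the new output nodes
read the last merged layer, which contains both old output layers. -/
theorem diff_feedsForward (h : SameDims P) : FeedsForward ((P false).inputs.map (inTag ++ ·))
    (diffHidden hid P ++ [(outPairs P).map (diffNode hid)]) := by
  refine ⟨fun v hv e he => relays_edges hid hv he, (feedsForward_append _ _ _).2 ?_⟩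
  refine ⟨feedsForward_zipLayers _ _ _ ?_ ?_, ?_, trivial⟩
  · rw [tagLayers_reverse, revLayers_reverse]
    exact feedsForward_tagLayers _ _ (P false).feedsForward fun s hs =>
      List.mem_append_right _ (mem_layerNames_relays hid h false hs)
  · rw [tagLayers_reverse, revLayers_reverse]
    exact feedsForward_tagLayers _ _ (P true).feedsForward fun s hs =>
      List.mem_append_right _ (mem_layerNames_relays hid h true hs)
  · intro v hv e he
    obtain ⟨p, hp, rfl⟩ := List.mem_map.1 hv
    refine List.mem_append_right _ (List.mem_flatMap.2 ⟨_, ?_, mem_outputs_merged hid hp he⟩)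
    rw [mergedLayers_eq]
    simp

/-- The network that computes the difference of two networks. -/
def diffNetwork (h : SameDims P) : Network F where
  inputs := (P false).inputs.map (inTag ++ ·)
  hidden := diffHidden hid P
  output := (outPairs P).map (diffNode hid)
  names_nodup := diff_names_nodup hid h
  edges_nodup := diff_edges_nodup hid
  feedsForward := diff_feedsForward hid h

theorem diffNetwork_isStrict (h : SameDims P) (hs : ∀ b, (P b).IsStrict)
    (hl : (P false).hidden.length = (P true).hidden.length) :
    (diffNetwork hid h).IsStrict := by
  refine ⟨fun v hv e he => relays_edges hid hv he, (feedsConsecutively_concat _ _ _).2 ?_⟩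
  refine ⟨feedsConsecutively_zipLayers _ _ _ ?_ ?_ ?_, ?_⟩
  · rw [tagLayers_reverse, revLayers_reverse]
    exact feedsConsecutively_tagLayers _ _ (hs false) fun s hs =>
      mem_layerNames_relays hid h false hs
  · rw [tagLayers_reverse, revLayers_reverse]
    exact feedsConsecutively_tagLayers _ _ (hs true) fun s hs =>
      mem_layerNames_relays hid h true hs
  · simp [tagLayers, revLayers, hl]
  · intro v hv e he
    obtain ⟨p, hp, rfl⟩ := List.mem_map.1 hv
    rw [mergedLayers_eq]
    simpa [lastNames] using mem_outputs_merged hid hp he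

variable (P) in
/-- The names of the hidden nodes that the output nodes of the difference read. -/
def diffSet : Finset NodeName :=
  ((layerNames (P true).output).map (sideTag true ++ ·) ++
    (layerNames (P false).output).map (sideTag false ++ ·)).toFinset

theorem mem_diffSet {b : Bool} {s : NodeName} :
    sideTag b ++ s ∈ diffSet P ↔ s ∈ layerNames (P b).output := by
  cases b <;> simp [diffSet, sideTag]

theorem diffSet_hidden (h : SameDims P) :
    ∀ s ∈ diffSet P, s ∈ (diffNetwork hid h).hiddenNames := by
  intro s hs
  refine List.mem_flatMap.2 ⟨(P true).output.map (tagNode (sideTag true)) ++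
      (P false).output.map (tagNode (sideTag false)), ?_, ?_⟩
  · simp [diffNetwork, diffHidden, mergedLayers_eq]
  · rw [diffSet, List.mem_toFinset, ← layerNames_tagNode, ← layerNames_tagNode] at hs
    simpa [layerNames] using hs

/-! ### The function computed by the difference -/

/-- Values of the tagged nodes agree with values of the nodes of two networks. -/
def Tracks (val : NodeName → ℝ) (vals : Bool → NodeName → ℝ) : Prop :=
  ∀ b s, val (sideTag b ++ s) = vals b s

theorem Tracks.value_tagNode {val : NodeName → ℝ} {vals : Bool → NodeName → ℝ}
    (h : Tracks val vals) (b : Bool) (v : Node F) :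
    (tagNode (sideTag b) v).value val = v.value (vals b) := by
  simp only [Node.value, tagNode, List.map_map, Function.comp_def, h b]

theorem Tracks.runLayer_tagNode {val : NodeName → ℝ} {vals : Bool → NodeName → ℝ}
    (h : Tracks val vals) (b : Bool) (l : List (Node F)) (s : NodeName) :
    runLayer val (l.map (tagNode (sideTag b))) (sideTag b ++ s) = runLayer (vals b) l s := by
  induction l with
  | nil => exact h b s
  | cons v l ih =>
    rw [List.map_cons, runLayer_cons, runLayer_cons, ih, h.value_tagNode]
    simp [tagNode]

theorem not_mem_layerNames_tag {b c : Bool} (h : c ≠ b) (l : List (Node F)) (s : NodeName) :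
    sideTag b ++ s ∉ layerNames (l.map (tagNode (sideTag c))) := by
  rw [layerNames_tagNode]
  simp [sideTag, h]

theorem runLayer_append_of_not_mem (val : NodeName → ℝ) (l l' : List (Node F)) (s : NodeName)
    (h : s ∉ layerNames l') : runLayer val (l ++ l') s = runLayer val l s := by
  rw [runLayer_append]
  split_ifs with h'
  · rfl
  · rw [runLayer_of_not_mem _ _ _ h, runLayer_of_not_mem _ _ _ h']

/-- The two halves of a merged layer have names with different tags, so neither overwrites or reads
values of the other. -/
theorem Tracks.runLayer_merged {val : NodeName → ℝ} {vals : Bool → NodeName → ℝ}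
    (h : Tracks val vals) (L : Bool → List (Node F)) :
    Tracks (runLayer val ((L true).map (tagNode (sideTag true)) ++
      (L false).map (tagNode (sideTag false)))) fun b => runLayer (vals b) (L b) := by
  rintro (_ | _) s
  · rw [runLayer_append, if_neg (not_mem_layerNames_tag (by decide) _ _)]
    exact h.runLayer_tagNode false _ s
  · rw [runLayer_append_of_not_mem _ _ _ _ (not_mem_layerNames_tag (by decide) _ _)]
    exact h.runLayer_tagNode true _ s

/-- This covers the surplus layers of the deeper network, which run alone before the merged layers.
-/
theorem Tracks.foldl_single {val : NodeName → ℝ} {vals : Bool → NodeName → ℝ}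
    (h : Tracks val vals) (c : Bool) (ls : List (List (Node F))) :
    Tracks ((tagLayers (sideTag c) ls).foldl runLayer val) fun b =>
      if b = c then ls.foldl runLayer (vals b) else vals b := by
  induction ls generalizing val vals with
  | nil => intro b s; simpa [tagLayers] using h b s
  | cons l ls ih =>
    have h' : Tracks (runLayer val (l.map (tagNode (sideTag c)))) fun b =>
        if b = c then runLayer (vals b) l else vals b := by
      intro b s
      dsimp only
      split_ifs with hb
      · subst hb; exact h.runLayer_tagNode b l s
      · rw [runLayer_of_not_mem _ _ _ (not_mem_layerNames_tag (Ne.symm hb) _ _)]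
        exact h b s
    intro b s
    refine (ih h' b s).trans ?_
    dsimp only
    split_ifs <;> rfl

theorem Tracks.foldl_zipLayers {val : NodeName → ℝ} {vals : Bool → NodeName → ℝ}
    (h : Tracks val vals) (as bs : List (List (Node F))) :
    Tracks ((zipLayers (tagLayers (sideTag false) as) (tagLayers (sideTag true) bs)).reverse.foldl
      runLayer val) fun b => (bif b then bs else as).reverse.foldl runLayer (vals b) := by
  induction as, bs using zipLayers.induct with
  | case1 bs =>
    intro b s
    refine Eq.trans ?_ ((h.foldl_single true bs.reverse b s).trans ?_)
    · rw [← tagLayers_reverse]; rfl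
    · cases b <;> rfl
  | case2 l as =>
    intro b s
    refine Eq.trans ?_ ((h.foldl_single false (l :: as).reverse b s).trans ?_)
    · rw [← tagLayers_reverse]; rfl
    · cases b <;> rfl
  | case3 l as l' bs ih =>
    intro b s
    have := ih.runLayer_merged (fun b => bif b then l' else l) b s
    refine Eq.trans ?_ (this.trans ?_)
    · simp [tagLayers, zipLayers]
    · cases b <;> simp

theorem inputVal_map_append (t : List Bool) (ins : List NodeName) (x : ℕ → ℝ) (s : NodeName) :
    inputVal (ins.map (t ++ ·)) x (t ++ s) = inputVal ins x s := by
  have : (ins.map (t ++ ·)).idxOf (t ++ s) = ins.idxOf s := by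
    induction ins with
    | nil => rfl
    | cons a l ih =>
      have : (t ++ a == t ++ s) = (a == s) := by simp [beq_eq_decide]
      simp [List.idxOf_cons, ih, this]
  simp only [inputVal, this]
  simp

/-- With the prescribed values given by a function `g` of the name, every relay with a given name
has the same value, so the induction needs no distinctness of names. -/
theorem runLayer_relays (b : Bool) (l : List (NodeName × NodeName)) (val g : NodeName → ℝ)
    (hg : ∀ p ∈ l, val (inTag ++ p.1) = g (bif b then p.2 else p.1)) (s : NodeName)
    (hs : s ∈ l.map fun p => bif b then p.2 else p.1) :
    runLayer val (l.flatMap (relays hid)) (sideTag b ++ s) = g s := by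
  induction l with
  | nil => simp at hs
  | cons p l ih =>
    have hp := hg p (by simp)
    have ih' := ih fun q hq => hg q (by simp [hq])
    rw [List.flatMap_cons, relays, List.cons_append, List.cons_append, List.nil_append,
      runLayer_cons, runLayer_cons]
    cases b
    · by_cases h : p.1 = s
      · subst h
        simpa [relay, Node.value, idAct] using hp
      · have hs' : s ∈ l.map fun p => bif false then p.2 else p.1 := by
          simpa [Ne.symm h] using hs
        simpa [relay, h, sideTag] using ih' hs'
    · by_cases h : p.2 = s
      · subst h
        simpa [relay, Node.value, idAct, sideTag] using hp
      · have hs' : s ∈ l.map fun p => bif true then p.2 else p.1 := by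
          simpa [Ne.symm h] using hs
        simpa [relay, h, sideTag] using ih' hs'

theorem tracks_relays (h : SameDims P) (x : ℕ → ℝ) :
    Tracks (runLayer (inputVal ((P false).inputs.map (inTag ++ ·)) x)
      ((inPairs P).flatMap (relays hid))) fun b => inputVal (P b).inputs x := by
  intro b s
  have hsel : ((inPairs P).map fun p => bif b then p.2 else p.1) = (P b).inputs := by
    cases b
    · exact inPairs_fst h
    · exact inPairs_snd h
  by_cases hs : s ∈ (P b).inputs
  · refine runLayer_relays hid b _ _ _ (fun p hp => ?_) s (by rwa [hsel])
    rw [inputVal_map_append]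
    cases b
    · rfl
    -- Input names are distinct, so both names of the `i`-th pair have index `i` and receive the
    -- same entry of `x`.
    · obtain ⟨i, hi, rfl⟩ := List.mem_iff_getElem.1 hp
      have hnd : ∀ b, (P b).inputs.Nodup := fun b => (P b).names_nodup.of_append_left
      simp only [inPairs, List.getElem_zip, cond_true, inputVal, List.getElem_mem, if_true,
        (hnd _).idxOf_getElem]
  -- Away from the inputs both sides have the default value 0.
  · rw [runLayer_of_not_mem]
    · refine (inputVal_of_not_mem ?_ x).trans (inputVal_of_not_mem hs x).symm
      cases b <;> simp [sideTag, inTag]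
    · rw [(layerNames_relays hid _).mem_iff, inPairs_fst h, inPairs_snd h]
      cases b <;> simpa [sideTag] using hs

theorem runLayer_self (val : NodeName → ℝ) {l : List (Node F)} (hl : (layerNames l).Nodup)
    {v : Node F} (hv : v ∈ l) : runLayer val l v.name = v.value val := by
  induction l with
  | nil => simp at hv
  | cons u l ih =>
    rw [runLayer_cons]
    rcases List.mem_cons.1 hv with rfl | hv
    · rw [if_pos rfl]
    · have hl' := List.nodup_cons.1 hl
      rw [if_neg, ih hl'.2 hv]
      intro huv
      exact hl'.1 (huv ▸ List.mem_map_of_mem hv)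

theorem Network.nodup_output (N : Network F) : (layerNames N.output).Nodup :=
  (N.hiddenNames_nodup_append.of_append_right).of_append_right

theorem outputs_diffNetwork (h : SameDims P) (x : ℕ → ℝ) :
    (diffNetwork hid h).outputs x =
      List.zipWith (fun y z => y - z) ((P false).outputs x) ((P true).outputs x) := by
  have ht := (tracks_relays hid h x).foldl_zipLayers (revLayers (P false)) (revLayers (P true))
  -- The old output nodes are now hidden and hold the two output vectors.
  have hv : ∀ b, ∀ v ∈ (P b).output, (diffHidden hid P).foldl runLayer
      (inputVal ((P false).inputs.map (inTag ++ ·)) x) (sideTag b ++ v.name) =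
      v.value ((P b).hidden.foldl runLayer (inputVal (P b).inputs x)) := by
    intro b v hv
    refine (ht b v.name).trans ?_
    have : (bif b then revLayers (P true) else revLayers (P false)).reverse =
        (P b).hidden ++ [(P b).output] := by
      cases b <;> exact revLayers_reverse _
    dsimp only
    rw [this, List.foldl_append]
    exact runLayer_self _ (P b).nodup_output hv
  simp only [Network.outputs, diffNetwork, outPairs, layerNames, List.zipWith_map, List.zip_eq_zipWith, List.map_zipWith]
  refine List.ext_getElem (by simp) fun i h1 h2 => ?_
  simp only [List.getElem_zipWith, diffNode, Node.value,
    idAct, List.map_cons, List.map_nil, List.sum_cons, List.sum_nil]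
  rw [hv false _ (List.getElem_mem _), hv true _ (List.getElem_mem _)]
  simp [Node.value, sub_eq_add_neg]

/-- Both edges of every output node start in `diffSet`; what is left is the identity applied to the
bias 0, whatever the other nodes compute. -/
theorem outputs_diffNetwork_delete (h : SameDims P) (x : ℕ → ℝ) :
    ((diffNetwork hid h).delete (diffSet P)).outputs x = (outPairs P).map fun _ => 0 := by
  simp only [Network.outputs, Network.delete, diffNetwork, List.map_map]
  refine List.map_congr_left fun p hp => ?_
  obtain ⟨h1, h2⟩ := mem_layerNames_outPairs hp
  simp [Node.value, Node.dropEdges, diffNode, mem_diffSet, h1, h2, idAct]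

theorem diffNetwork_sameFunction_iff (h : SameDims P) :
    (diffNetwork hid h).SameFunction ((diffNetwork hid h).delete (diffSet P)) ↔
      (P false).SameFunction (P true) := by
  rw [Network.sameFunction_iff, Network.sameFunction_iff]
  simp only [outputs_diffNetwork, outputs_diffNetwork_delete]
  refine and_congr (by simp [diffNetwork, Network.delete, h.1]) (forall_congr' fun x => ?_)
  have hl : ((P false).outputs x).length = ((P true).outputs x).length := by
    rw [Network.length_outputs, Network.length_outputs]; exact h.2
  have hp : ((outPairs P).map fun _ => (0 : ℝ)) =
      List.replicate ((P false).outputs x).length 0 := by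
    rw [List.map_const', Network.length_outputs, Network.outDim]
    simp [outPairs, layerNames, h.2]
  rw [hp]
  generalize (P false).outputs x = l at hl
  generalize (P true).outputs x = l' at hl
  induction l generalizing l' with
  | nil => cases l' <;> simp_all
  | cons a l ih =>
    cases l' with
    | nil => simp at hl
    | cons a' l' => simp [List.replicate_succ, sub_eq_zero, ih l' (by simpa using hl)]

theorem sameDims_of_sameFunction (h : (P false).SameFunction (P true)) : SameDims P :=
  ⟨h.1.symm, h.2.1⟩

end Difference

/-! ### A necessary node -/

section Constant

variable (hid : (id : ℝ → ℝ) ∈ F)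

/-- A network with one hidden node, which computes `1`, and one output node, which copies it. -/
def oneNetwork : Network F where
  inputs := []
  hidden := [[⟨[], idAct hid, 1, []⟩]]
  output := [⟨[true], idAct hid, 0, [([], 1)]⟩]
  names_nodup := by simp [layerNames]
  edges_nodup := by simp
  feedsForward := by simp [FeedsForward, layerNames]

theorem oneNetwork_isStrict : (oneNetwork hid).IsStrict := by
  simp [Network.IsStrict, oneNetwork, FeedsConsecutively, layerNames]

/-- Deletion turns the constant output 1 into 0. This is the image of all pairs with different
dimensions. -/
theorem oneNetwork_not_sameFunction :
    ¬ (oneNetwork hid).SameFunction ((oneNetwork hid).delete {[]}) := by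
  rw [Network.sameFunction_iff]
  rintro ⟨-, h⟩
  have := h 0
  simp [Network.outputs, oneNetwork, Network.delete, Node.value, Node.dropEdges, runLayer,
    idAct] at this

end Constant

end NeuralNet

/-! ### The silencing reduction on a stack machine. -/

namespace NeuralNet

variable {F : Set (ℝ → ℝ)}

/-! ### Words that occur in encodings -/

/-- The symbols that occur in a node after the symbol `act`. -/
def Sym.inner : Sym → Bool
  | bit _ | sign _ | slash | bias | edge | weight => true
  | _ => false

theorem inner_encodeBits (s : List Bool) : ∀ a ∈ encodeBits s, a.inner = true := by
  simp only [encodeBits, List.mem_map]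
  rintro _ ⟨b, -, rfl⟩
  rfl

theorem inner_encodeRat (q : ℚ) : ∀ a ∈ encodeRat q, a.inner = true := by
  have := inner_encodeBits
  simp only [encodeRat, List.cons_append, List.mem_cons, List.mem_append]
  rintro a (rfl | h | rfl | h)
  exacts [rfl, this _ _ h, rfl, this _ _ h]

theorem inner_encodeEdge (e : NodeName × ℚ) : ∀ a ∈ encodeEdge e, a.inner = true := by
  simp only [encodeEdge, List.cons_append, List.mem_cons, List.mem_append]
  rintro a (rfl | h | rfl | h)
  exacts [rfl, inner_encodeBits _ _ h, rfl, inner_encodeRat _ _ h]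

/-- The part of the encoding of a node after the symbol `act`. -/
def nodeTail (code : F → List Bool) (v : Node F) : List Sym :=
  encodeBits (code v.act) ++ Sym.bias :: encodeRat v.bias ++ v.edges.flatMap encodeEdge

/-- None of these symbols starts a node, a layer or the output, so the end of a node is recognised
by the first symbol that is not inner. -/
theorem inner_nodeTail (code : F → List Bool) (v : Node F) :
    ∀ a ∈ nodeTail code v, a.inner = true := by
  simp only [nodeTail, List.append_assoc, List.cons_append, List.mem_cons, List.mem_append,
    List.mem_flatMap]
  rintro a (h | rfl | h | ⟨e, -, h⟩)
  exacts [inner_encodeBits _ _ h, rfl, inner_encodeRat _ _ h, inner_encodeEdge _ _ h]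

theorem encodeNode_eq (code : F → List Bool) (Y : Finset NodeName) (v : Node F) :
    encodeNode code Y v = Sym.node :: Sym.mark (decide (v.name ∈ Y)) ::
      (encodeBits v.name ++ Sym.act :: nodeTail code v) := by
  simp [encodeNode, nodeTail]

/-- The part after the symbol `act` of a node with bias `0` and the activation function that is
named by `cid`. -/
def zeroTail (cid : List Bool) : List Sym := encodeBits cid ++ Sym.bias :: encodeRat 0

theorem length_zeroTail (cid : List Bool) : (zeroTail cid).length = cid.length + 4 := by
  simp [zeroTail, encodeBits, encodeRat]

/-! ### The machine that silences the marked nodes -/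

/-- The stacks of the machine. -/
inductive SilenceStack
  | source
  | plain
  | silent
  | target
  deriving DecidableEq

instance : Fintype SilenceStack :=
  ⟨{.source, .plain, .silent, .target}, fun k => by cases k <;> decide⟩

/-- The states of the machine. -/
inductive SilenceState
  | copy
  | name
  | skip
  | emitSilent
  | emitPlain
  deriving DecidableEq

instance : Fintype SilenceState :=
  ⟨{.copy, .name, .skip, .emitSilent, .emitPlain}, fun q => by cases q <;> decide⟩

open StackMachine SilenceStack SilenceState

/-- Push a word to both copies. -/
def both (w : List Sym) : List (SilenceStack × Sym) :=
  w.flatMap fun a => [(plain, a), (silent, a)]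

/-- The pushes of the machine. -/
def silenceOut (cid : List Bool) : SilenceState → Option Sym → List (SilenceStack × Sym)
  | copy, some (.mark _) => both [.mark false]
  | copy, some a => both [a]
  | name, some .act =>
      (plain, .act) :: (silent, .act) :: (zeroTail cid).map fun a => (silent, a)
  | name, some a => both [a]
  | skip, some a => if a.inner then [(plain, a)] else both [a]
  | emitSilent, some a => [(target, a)]
  | emitSilent, none => [(target, .next)]
  | emitPlain, some a => [(target, a)]
  | _, none => []

/-- The transitions of the machine. -/
def silenceNext : SilenceState → Option Sym → Option SilenceState
  | copy, some (.mark true) => some name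
  | copy, some _ => some copy
  | copy, none => some emitSilent
  | name, some .act => some skip
  | name, some _ => some name
  | name, none => none
  | skip, some a => some (if a.inner then skip else copy)
  | skip, none => some emitSilent
  | emitSilent, some _ => some emitSilent
  | emitSilent, none => some emitPlain
  | emitPlain, some _ => some emitPlain
  | emitPlain, none => none

/-- The stacks that the machine pops. -/
def silenceSrc : SilenceState → SilenceStack
  | emitSilent => silent
  | emitPlain => plain
  | _ => source

/-- A machine that writes down a network without marks and then, as a second network, the same
network with its marked nodes silenced. -/
def silenceMachine (cid : List Bool) : StackMachine SilenceStack SilenceState Sym where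
  src := silenceSrc
  next := silenceNext
  out := silenceOut cid

/-- Weights of the stacks. -/
def silenceWeight (cid : List Bool) : SilenceStack → ℕ
  | source => 2 * cid.length + 20
  | plain => 2
  | silent => 2
  | target => 1

/-- Weights of the states. -/
def silenceStateWeight : SilenceState → ℕ
  | emitSilent => 3
  | emitPlain => 1
  | _ => 4

/-- The dearest symbol is `act` in a marked node: one `act` on each copy and `cid.length + 4`
further symbols on `silent`, at 2 each, fit into the weight `2 * cid.length + 20` of a source
symbol. Moving a symbol from weight 2 to weight 1 pays for the final loops. -/
theorem silenceMachine_decreasing (cid : List Bool) :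
    (silenceMachine cid).Decreasing (silenceWeight cid) silenceStateWeight := by
  rintro q (_ | a)
  · cases q <;> simp [silenceMachine, silenceNext, silenceOut, statePot, silenceStateWeight,
      silenceWeight]
  · cases q <;> cases a <;> (try rename_i b; cases b) <;>
      simp [silenceMachine, silenceNext, silenceOut, statePot, silenceStateWeight,
      silenceWeight, silenceSrc, both, Sym.inner, Function.comp_def, length_zeroTail] <;> omega

@[simp] theorem proj_both_source (w : List Sym) : proj source (both w) = [] := by
  simp [both, proj_flatMap]

@[simp] theorem proj_both_plain (w : List Sym) : proj plain (both w) = w := by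
  simp [both, proj_flatMap]

@[simp] theorem proj_both_silent (w : List Sym) : proj silent (both w) = w := by
  simp [both, proj_flatMap]

@[simp] theorem proj_both_target (w : List Sym) : proj target (both w) = [] := by
  simp [both, proj_flatMap]

theorem proj_map_mk {K Γ : Type} [DecidableEq K] (k k' : K) (w : List Γ) :
    proj k (w.map fun a => (k', a)) = if k' = k then w else [] := by
  split_ifs with h <;> simp [proj, List.filterMap_map, h]

section Correct

variable (code : F → List Bool) (cid : List Bool) (Y : Finset NodeName)

/-- The states between two nodes. -/
def SilenceState.idle (q : SilenceState) : Prop := q = copy ∨ q = skip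

/-- The pushes caused by a node. -/
def silenceLog (v : Node F) : List (SilenceStack × Sym) :=
  if v.name ∈ Y then
    both [.node, .mark false] ++ both (encodeBits v.name) ++
      ((plain, Sym.act) :: (silent, Sym.act) :: (zeroTail cid).map fun a => (silent, a)) ++
      (nodeTail code v).map fun a => (plain, a)
  else both (encodeNode code ∅ v)

theorem both_append (w w' : List Sym) : both (w ++ w') = both w ++ both w' := by
  simp [both]

theorem reads_both (q : SilenceState) (hq : silenceSrc q = source) (w : List Sym)
    (hw : ∀ a ∈ w, silenceNext q (some a) = some q ∧ silenceOut cid q (some a) = both [a]) :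
    (silenceMachine cid).Reads source q w q (both w) :=
  Reads.loop (M := silenceMachine cid) (f := fun a => [(plain, a), (silent, a)]) hq w
    (fun a ha => (hw a ha).1) (fun a ha => (hw a ha).2) (by simp)

theorem reads_bits (q : SilenceState) (h : q = copy ∨ q = name) (s : List Bool) :
    (silenceMachine cid).Reads source q (encodeBits s) q (both (encodeBits s)) := by
  refine reads_both cid q (by rcases h with rfl | rfl <;> rfl) _ ?_
  simp only [encodeBits, List.mem_map]
  rintro _ ⟨b, -, rfl⟩
  rcases h with rfl | rfl <;> exact ⟨rfl, rfl⟩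

theorem reads_single_both (q q' : SilenceState) (a a' : Sym) (hk : silenceSrc q = source)
    (hn : silenceNext q (some a) = some q') (ho : silenceOut cid q (some a) = both [a']) :
    (silenceMachine cid).Reads source q [a] q' (both [a']) := by
  have := Reads.singleton (M := silenceMachine cid) (q := q) (a := a) hk hn
    (by rw [show (silenceMachine cid).out = silenceOut cid from rfl, ho]; simp)
  rwa [show (silenceMachine cid).out = silenceOut cid from rfl, ho] at this

theorem reads_delimiter (q : SilenceState) (hq : q.idle) (a : Sym)
    (ha : a = .node ∨ a = .layer ∨ a = .output) :
    (silenceMachine cid).Reads source q [a] copy (both [a]) := by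
  rcases hq with rfl | rfl <;> rcases ha with rfl | rfl | rfl <;>
    exact reads_single_both cid _ _ _ _ rfl rfl rfl

/-- After a marked node the machine is still skipping, after an unmarked one it is copying; a
delimiter has the same effect in both states. -/
theorem reads_silenceNode (v : Node F) (q : SilenceState) (hq : q.idle) :
    ∃ q', q'.idle ∧
      (silenceMachine cid).Reads source q (encodeNode code Y v) q' (silenceLog code cid Y v) := by
  have h1 := reads_delimiter cid q hq .node (by simp)
  by_cases hv : v.name ∈ Y
  · refine ⟨skip, Or.inr rfl, ?_⟩
    have h2 := reads_single_both cid copy name (.mark true) (.mark false) rfl rfl rfl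
    have h3 := reads_bits cid name (by simp) v.name
    have h4 := Reads.singleton (M := silenceMachine cid) (k := source) (q := name) (q' := skip)
      (a := Sym.act) rfl rfl (by
        simp [silenceMachine, silenceOut, proj_map_mk])
    have h5 : (silenceMachine cid).Reads source skip (nodeTail code v) skip
        ((nodeTail code v).map fun a => (plain, a)) := by
      have := Reads.loop (M := silenceMachine cid) (k := source) (q := skip) rfl
        (fun a => [(plain, a)]) (nodeTail code v) ?_ ?_ (by simp)
      · exact this.congr rfl (List.flatMap_pure_eq_map _ _)
      · intro a ha
        simp [silenceMachine, silenceNext, inner_nodeTail code v a ha]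
      · intro a ha
        simp [silenceMachine, silenceOut, inner_nodeTail code v a ha]
    have h := h1.append (h2.append (h3.append (h4.append h5)))
    rw [encodeNode_eq]
    simp only [hv, decide_true, silenceLog, if_true]
    refine h.congr (by simp) ?_
    simp [silenceMachine, silenceOut, both]
  · refine ⟨copy, Or.inl rfl, ?_⟩
    have h2 := reads_single_both cid copy copy (.mark false) (.mark false) rfl rfl rfl
    have h3 := reads_bits cid copy (by simp) v.name
    have h4 := reads_single_both cid copy copy .act .act rfl rfl rfl
    have h5 : (silenceMachine cid).Reads source copy (nodeTail code v) copy
        (both (nodeTail code v)) := by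
      refine reads_both cid copy rfl _ fun a ha => ?_
      have := inner_nodeTail code v a ha
      cases a <;> first | exact ⟨rfl, rfl⟩ | simp [Sym.inner] at this
    have h := h1.append (h2.append (h3.append (h4.append h5)))
    simp only [← both_append] at h
    rw [encodeNode_eq]
    refine h.congr (by simp [hv]) ?_
    simp [silenceLog, hv, encodeNode_eq]

/-- The pushes caused by a layer. -/
def silenceLayerLog (l : List (Node F)) : List (SilenceStack × Sym) :=
  both [.layer] ++ l.flatMap (silenceLog code cid Y)

/-- The pushes caused by a network. -/
def silenceNetworkLog (N : Network F) : List (SilenceStack × Sym) :=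
  both (N.inputs.flatMap fun s => Sym.input :: encodeBits s) ++
    N.hidden.flatMap (silenceLayerLog code cid Y) ++
    both [.output] ++ N.output.flatMap (silenceLog code cid Y)

theorem reads_silenceNetwork (N : Network F) :
    ∃ q', q'.idle ∧ (silenceMachine cid).Reads source copy (encodeNetwork code N Y) q'
      (silenceNetworkLog code cid Y N) := by
  have hl : ∀ (l : List (Node F)) (q : SilenceState), q.idle → ∃ q', q'.idle ∧
      (silenceMachine cid).Reads source q (l.flatMap (encodeNode code Y)) q'
        (l.flatMap (silenceLog code cid Y)) := fun l =>
    Reads.flatMap _ _ _ l fun v _ q hq => reads_silenceNode code cid Y v q hq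
  have h1 : (silenceMachine cid).Reads source copy
      (N.inputs.flatMap fun s => Sym.input :: encodeBits s) copy
      (both (N.inputs.flatMap fun s => Sym.input :: encodeBits s)) := by
    refine reads_both cid copy rfl _ ?_
    simp only [List.mem_flatMap, List.mem_cons, encodeBits, List.mem_map]
    rintro _ ⟨s, -, rfl | ⟨b, -, rfl⟩⟩ <;> exact ⟨rfl, rfl⟩
  obtain ⟨q2, hq2, h2⟩ := Reads.flatMap (M := silenceMachine cid) (k := source) SilenceState.idle
    (fun l => Sym.layer :: l.flatMap (encodeNode code Y)) (silenceLayerLog code cid Y) N.hidden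
    (fun l _ q hq => by
      obtain ⟨q', hq', h⟩ := hl l copy (Or.inl rfl)
      exact ⟨q', hq', (reads_delimiter cid q hq .layer (by simp)).append h⟩) copy (Or.inl rfl)
  obtain ⟨q3, hq3, h3⟩ := hl N.output copy (Or.inl rfl)
  have h := ((h1.append h2).append (reads_delimiter cid q2 hq2 .output (by simp))).append h3
  refine ⟨q3, hq3, ?_⟩
  exact h.congr (by simp [encodeNetwork]) rfl

theorem proj_silenceLog_plain (v : Node F) :
    proj plain (silenceLog code cid Y v) = encodeNode code ∅ v := by
  unfold silenceLog
  split_ifs <;> simp [proj_map_mk, encodeNode_eq]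

theorem proj_silenceLog_silent (hid : (id : ℝ → ℝ) ∈ F) (v : Node F) :
    proj silent (silenceLog code (code (idAct hid)) Y v) =
      encodeNode code ∅ (silence hid Y v) := by
  unfold silenceLog silence
  split_ifs <;> simp [proj_map_mk, encodeNode_eq, nodeTail, zeroTail]

theorem proj_silenceNetworkLog_plain (N : Network F) :
    proj plain (silenceNetworkLog code cid Y N) = encodeNetwork code N ∅ := by
  simp only [silenceNetworkLog, silenceLayerLog, proj_append, proj_flatMap, proj_both_plain,
    proj_silenceLog_plain, encodeNetwork]
  simp

theorem proj_silenceNetworkLog_silent (hid : (id : ℝ → ℝ) ∈ F) (N : Network F) :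
    proj silent (silenceNetworkLog code (code (idAct hid)) Y N) =
      encodeNetwork code (N.silence hid Y) ∅ := by
  simp only [silenceNetworkLog, silenceLayerLog, proj_append, proj_flatMap, proj_both_silent,
    proj_silenceLog_silent, encodeNetwork, Network.silence]
  simp [List.flatMap_map]

theorem proj_silenceLog_other (v : Node F) {k : SilenceStack} (hk : k = source ∨ k = target) :
    proj k (silenceLog code cid Y v) = [] := by
  unfold silenceLog
  rcases hk with rfl | rfl <;> split_ifs <;> simp [proj_map_mk]

theorem proj_silenceNetworkLog_other (N : Network F) {k : SilenceStack}
    (hk : k = source ∨ k = target) : proj k (silenceNetworkLog code cid Y N) = [] := by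
  have := fun v : Node F => proj_silenceLog_other code cid Y v hk
  rcases hk with rfl | rfl <;>
  simp [silenceNetworkLog, silenceLayerLog, proj_append, proj_flatMap, this]

theorem reaches_silence (hid : (id : ℝ → ℝ) ∈ F) (N : Network F) :
    (silenceMachine (code (idAct hid))).Reaches
      (some copy, single source (encodeNetwork code N Y))
      (none, single target (encodeNetwork code N ∅ ++
        Sym.next :: encodeNetwork code (N.silence hid Y) ∅)) := by
  obtain ⟨q, hq, h⟩ := reads_silenceNetwork code (code (idAct hid)) Y N
  refine (h.2 _ [] (by simp [single])).trans ?_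
  set S := pushAll (Function.update (single source (encodeNetwork code N Y)) source [])
    (silenceNetworkLog code (code (idAct hid)) Y N) with hS
  have hS1 : S source = [] := by
    simp [hS, pushAll_apply, proj_silenceNetworkLog_other code _ Y N]
  have hS2 : S target = [] := by
    simp [hS, pushAll_apply, proj_silenceNetworkLog_other code _ Y N, single]
  have hS3 : S plain = (encodeNetwork code N ∅).reverse := by
    simp [hS, pushAll_apply, proj_silenceNetworkLog_plain, single]
  have hS4 : S silent = (encodeNetwork code (N.silence hid Y) ∅).reverse := by
    simp [hS, pushAll_apply, proj_silenceNetworkLog_silent, single]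
  clear_value S
  have h1 : silenceNext q none = some emitSilent := by rcases hq with rfl | rfl <;> rfl
  have h2 : silenceSrc q = source := by rcases hq with rfl | rfl <;> rfl
  have h3 : silenceOut (code (idAct hid)) q none = [] := by rcases hq with rfl | rfl <;> rfl
  refine Reaches.empty (by rw [← hS1, ← h2]; rfl) ?_
  simp only [silenceMachine, h1, h3, pushAll]
  -- The second network of the pair is written before the first, so that the first ends on top.
  refine Reaches.move (M := silenceMachine _) (q := emitSilent) (k := target)
    (show target ≠ silent by decide) _ [] S _ (fun _ _ => rfl) (fun _ _ => rfl)
    (show S silent = _ by rw [List.append_nil]) ?_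
  refine Reaches.empty (show _ = _ by simp [silenceMachine, silenceSrc]) ?_
  refine Reaches.move (M := silenceMachine _) (q := emitPlain) (k := target)
    (show target ≠ plain by decide) (S plain) [] _ _ (fun _ _ => rfl) (fun _ _ => rfl)
    (show _ = _ by simp [silenceMachine, silenceSrc, silenceOut, pushAll]) ?_
  refine Reaches.empty (show _ = _ by simp [silenceMachine, silenceSrc]) ?_
  refine Reaches.of_eq (funext fun k => ?_)
  cases k <;> simp [silenceMachine, silenceSrc, silenceOut, pushAll, single, hS1, hS2, hS3, hS4]

end Correct

end NeuralNet

/-! ### The machine for the difference and its potential. -/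

namespace NeuralNet

/-! ### The machine that builds the difference of two networks -/

/-- The occurrences of names in the relay nodes and in the output nodes of the difference. -/
inductive NameUse
  | diffRight
  | diffLeft
  | diffName
  | relaySrcTrue
  | relayNameTrue
  | relaySrcFalse
  | relayNameFalse
  deriving DecidableEq

instance : Fintype NameUse :=
  ⟨{.diffRight, .diffLeft, .diffName, .relaySrcTrue, .relayNameTrue, .relaySrcFalse,
    .relayNameFalse}, fun k => by cases k <;> decide⟩

/-- The stacks of the machine. -/
inductive DiffStack
  | source
  | target
  | ins
  | layers (b : Bool)
  | count (b : Bool)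
  | names (i : NameUse)
  | counter (b : Bool)
  deriving DecidableEq, Fintype

/-- The states of the machine. -/
inductive DiffState
  | readIn (b : Bool)
  | readHid (b : Bool)
  | readOut (b : Bool)
  | readName (b : Bool)
  | check
  | checkWith (a : Option Sym)
  | head (b : Bool)
  | copy (i : NameUse)
  | zipFalse
  | zipTrue
  | zipRest
  | emitIns
  | drain (i : Fin (Fintype.card DiffStack))
  deriving Fintype

open StackMachine DiffStack DiffState

/-- Push a word to a stack. -/
def toStack (k : DiffStack) (w : List Sym) : List (DiffStack × Sym) := w.map fun a => (k, a)

/-- Push a word to several stacks. -/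
def spread (ks : List DiffStack) (w : List Sym) : List (DiffStack × Sym) :=
  w.flatMap fun a => ks.map fun k => (k, a)

/-- The stacks that collect the names of the input nodes. -/
def inStacks : Bool → List DiffStack
  | false => [names .relaySrcTrue, names .relaySrcFalse, names .relayNameFalse]
  | true => [names .relayNameTrue]

/-- The stacks that collect the names of the output nodes. -/
def outStacks : Bool → List DiffStack
  | false => [names .diffLeft, names .diffName]
  | true => [names .diffRight]

/-- Insert a tag in front of the names. -/
def tagSym (b m : Bool) : Sym → List Sym
  | .mark _ => .mark m :: encodeBits (sideTag b)
  | .edge => .edge :: encodeBits (sideTag b)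
  | a => [a]

/-- The symbols of the difference in front of a name. -/
def prefixOf (cid : List Bool) : NameUse → List Sym
  | .diffRight => .weight :: encodeRat 1 ++ .edge :: encodeBits (sideTag true)
  | .diffLeft => .act :: zeroTail cid ++ .edge :: encodeBits (sideTag false)
  | .diffName => .node :: .mark false :: encodeBits outTag
  | .relaySrcTrue => .act :: zeroTail cid ++ .edge :: encodeBits inTag
  | .relayNameTrue =>
      .weight :: encodeRat 1 ++ .node :: .mark false :: encodeBits (sideTag true)
  | .relaySrcFalse => .act :: zeroTail cid ++ .edge :: encodeBits inTag
  | .relayNameFalse => .node :: .mark false :: encodeBits (sideTag false)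

/-- The state after copying a name. -/
def afterName : NameUse → DiffState
  | .diffRight => copy .diffLeft
  | .diffLeft => copy .diffName
  | .diffName => head false
  | .relaySrcTrue => copy .relayNameTrue
  | .relayNameTrue => copy .relaySrcFalse
  | .relaySrcFalse => copy .relayNameFalse
  | .relayNameFalse => head true

/-- The pushes of the machine. -/
def diffOut (cid : List Bool) (alt : List Sym) : DiffState → Option Sym → List (DiffStack × Sym)
  | readIn b, some (.bit x) =>
      spread (inStacks b) [.bit x] ++ bif b then [] else toStack ins [.bit x]
  | readIn b, some .input => (count b, .input) :: spread (inStacks b) [.input] ++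
      bif b then [] else toStack ins (.input :: encodeBits inTag)
  | readIn b, some .layer => [(layers b, .layer)]
  | readIn b, some .output => [(layers b, .layer)]
  | readHid b, some .output => [(layers b, .layer)]
  | readHid b, some a => toStack (layers b) (tagSym b false a)
  | readOut b, some (.mark x) => (count b, .node) :: spread (outStacks b) [.input] ++
      toStack (layers b) (tagSym b true (.mark x))
  | readOut _, some .next => []
  | readOut b, some a => toStack (layers b) (tagSym b true a)
  | readName b, some (.bit x) => (layers b, .bit x) :: spread (outStacks b) [.bit x]
  | readName b, some .act => [(layers b, .act)]
  | checkWith (some a), some a' =>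
      if a = a' then [(counter (decide (a = .input)), a)] else []
  | head false, some _ => toStack target (Sym.weight :: encodeRat (-1)).reverse
  | head true, some _ => toStack target (Sym.weight :: encodeRat 1).reverse
  | head false, none => [(target, .output)]
  | head true, none => [(target, .layer)]
  | copy _, some (.bit x) => [(target, .bit x)]
  | copy i, some _ => toStack target (prefixOf cid i).reverse
  | zipFalse, some .layer => []
  | zipFalse, some a => [(target, a)]
  | zipTrue, some a => [(target, a)]
  | zipTrue, none => [(target, .layer)]
  | zipRest, some a => [(target, a)]
  | emitIns, some a => [(target, a)]
  | drain i, none =>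
      if i.1 + 1 < Fintype.card DiffStack then [] else toStack target alt.reverse
  | _, _ => []

/-- The first state of the loop that empties all stacks. -/
def drainFirst : DiffState := drain ⟨0, Fintype.card_pos_iff.2 ⟨source⟩⟩

/-- The transitions of the machine. -/
def diffNext : DiffState → Option Sym → Option DiffState
  | readIn b, some (.bit _) => some (readIn b)
  | readIn b, some .input => some (readIn b)
  | readIn b, some .layer => some (readHid b)
  | readIn b, some .output => some (readOut b)
  | readHid b, some .output => some (readOut b)
  | readHid b, some _ => some (readHid b)
  | readOut b, some (.mark _) => some (readName b)
  | readOut _, some .next => some (readIn true)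
  | readOut b, some _ => some (readOut b)
  | readOut _, none => some check
  | readName b, some (.bit _) => some (readName b)
  | readName b, some .act => some (readOut b)
  | check, a => some (checkWith a)
  | checkWith a, a' =>
      some (if a = a' then (if a.isSome then check else head false) else drainFirst)
  | head false, some _ => some (copy .diffRight)
  | head true, some _ => some (copy .relaySrcTrue)
  | head false, none => some zipFalse
  | head true, none => some emitIns
  | copy i, some (.bit _) => some (copy i)
  | copy i, some _ => some (afterName i)
  | zipFalse, some .layer => some zipTrue
  | zipFalse, some _ => some zipFalse
  | zipFalse, none => some zipRest
  | zipTrue, some .layer => some zipFalse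
  | zipTrue, some _ => some zipTrue
  | zipTrue, none => some zipFalse
  | zipRest, some _ => some zipRest
  | zipRest, none => some (head true)
  | emitIns, some _ => some emitIns
  | drain i, some _ => some (drain i)
  | drain i, none => if h : i.1 + 1 < Fintype.card DiffStack then some (drain ⟨i.1 + 1, h⟩) else none
  | _, _ => none

/-- The stacks that the machine pops. -/
noncomputable def diffSrc : DiffState → DiffStack
  | check => count false
  | checkWith _ => count true
  | head b => counter b
  | copy i => names i
  | zipFalse => layers false
  | zipTrue => layers true
  | zipRest => layers true
  | emitIns => ins
  | drain i => (Fintype.equivFin DiffStack).symm i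
  | _ => source

/-- A machine that writes down the difference of two networks of the same dimensions, and the word
`alt` for networks of different dimensions. -/
noncomputable def diffMachine (cid : List Bool) (alt : List Sym) :
    StackMachine DiffStack DiffState Sym where
  src := diffSrc
  next := diffNext
  out := diffOut cid alt

/-- Weights of the stacks. -/
def diffWeight (cid : List Bool) : DiffStack → ℕ
  | source => 20 * cid.length + 1000
  | target => 1
  | ins => 2
  | layers _ => 5
  | count _ => 40
  | names _ => cid.length + 40
  | counter _ => 30

/-- Weights of the states. -/
def diffStateWeight (alt : List Sym) : DiffState → ℕ
  | readIn _ | readHid _ | readOut _ | readName _ => alt.length + Fintype.card DiffStack + 13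
  | check => alt.length + Fintype.card DiffStack + 11
  | checkWith _ => alt.length + Fintype.card DiffStack + 10
  | head false | copy .diffRight | copy .diffLeft | copy .diffName => 7
  | head true => 3
  | copy _ => 3
  | zipFalse => 5
  | zipTrue => 7
  | zipRest => 4
  | emitIns => 1
  | drain i => alt.length + (Fintype.card DiffStack - i.1)

theorem length_prefixOf (cid : List Bool) (i : NameUse) :
    (prefixOf cid i).length ≤ cid.length + 20 := by
  cases i <;> simp [prefixOf, length_zeroTail, encodeBits, encodeRat, sideTag, inTag, outTag]

theorem one_le_diffWeight (cid : List Bool) (k : DiffStack) : 1 ≤ diffWeight cid k := by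
  cases k <;> simp [diffWeight]

/-- A delimiter on a stack of names pays for a prefix of at most `cid.length + 20` symbols, a symbol
on `count` for one on `counter`, and that one for a written weight. `zipTrue` weighs 2 more than
`zipFalse`, since it may have to write a delimiter without popping anything. The reading and
comparing states carry enough for emptying all stacks and writing `alt`. -/
theorem diffMachine_decreasing (cid : List Bool) (alt : List Sym) :
    (diffMachine cid alt).Decreasing (diffWeight cid) (diffStateWeight alt) := by
  intro q a
  cases q with
  | drain i =>
    have hi := i.2
    have := one_le_diffWeight cid ((Fintype.equivFin DiffStack).symm i)
    rcases a with _ | a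
    · by_cases h : i.1 + 1 < Fintype.card DiffStack
      · simp [diffMachine, diffNext, diffOut, statePot, diffStateWeight, h]
        omega
      · simp [diffMachine, diffNext, diffOut, statePot, diffStateWeight, h, toStack, Function.comp_def,
          diffWeight]
        omega
    · simp [diffMachine, diffNext, diffOut, statePot, diffStateWeight, diffSrc]
      omega
  | checkWith b =>
    rcases b with _ | b <;> rcases a with _ | a
    · simp [diffMachine, diffNext, diffOut, statePot, diffStateWeight]
    · simp [diffMachine, diffNext, diffOut, statePot, diffStateWeight, drainFirst]
      omega
    · simp [diffMachine, diffNext, diffOut, statePot, diffStateWeight, drainFirst]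
    · by_cases h : b = a
      · simp [diffMachine, diffNext, diffOut, statePot, diffStateWeight, h, diffSrc, diffWeight]
      · simp [diffMachine, diffNext, diffOut, statePot, diffStateWeight, h, drainFirst]
        omega
  | copy i =>
    have := length_prefixOf cid i
    rcases a with _ | a
    · cases i <;> simp [diffMachine, diffNext, diffOut, statePot, diffStateWeight]
    · cases i <;> cases a <;>
      simp [diffMachine, diffNext, diffOut, statePot, diffStateWeight, diffSrc,
        toStack, Function.comp_def, afterName, diffWeight] <;> omega
  | readIn b | readHid b | readOut b | readName b | head b =>
    cases b
    all_goals
      rcases a with _ | a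
      · simp [diffMachine, diffNext, diffOut, statePot, diffStateWeight, diffWeight]
      · cases a <;>
        simp [diffMachine, diffNext, diffOut, statePot, diffStateWeight, diffSrc, diffWeight,
          toStack, tagSym, spread, inStacks, outStacks, encodeBits, sideTag,
          inTag, encodeRat] <;> (try omega)
  | check | zipFalse | zipTrue | zipRest | emitIns =>
    rcases a with _ | a
    · simp [diffMachine, diffNext, diffOut, statePot, diffStateWeight, diffWeight]
    · cases a <;>
      simp [diffMachine, diffNext, diffOut, statePot, diffStateWeight, diffSrc, diffWeight]

end NeuralNet

/-! ### Correctness of the comparing and writing phases. -/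

namespace NeuralNet

open StackMachine DiffStack DiffState Function

section Run

variable {cid : List Bool} {alt : List Sym}

theorem proj_toStack (k k' : DiffStack) (w : List Sym) :
    proj k (toStack k' w) = if k' = k then w else [] := proj_map_mk k k' w

theorem proj_spread (k : DiffStack) (ks : List DiffStack) (w : List Sym) :
    proj k (spread ks w) = w.flatMap fun a => proj k (ks.map fun k => (k, a)) :=
  proj_flatMap k w _

/-! ### Emptying all stacks -/

theorem reaches_drain_one (i : Fin (Fintype.card DiffStack)) (w : List Sym) :
    ∀ (S : DiffStack → List Sym) (c : Option DiffState × (DiffStack → List Sym)),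
      S ((Fintype.equivFin DiffStack).symm i) = w →
      (diffMachine cid alt).Reaches
        (some (drain i), update S ((Fintype.equivFin DiffStack).symm i) []) c →
      (diffMachine cid alt).Reaches (some (drain i), S) c := by
  induction w with
  | nil => intro S c hS h; rwa [← hS, update_eq_self] at h
  | cons a w ih =>
    intro S c hS h
    refine Reaches.pop (M := diffMachine cid alt) (q := drain i) hS ?_
    refine ih _ _ (update_self _ _ _) ?_
    simpa [diffMachine, diffNext, diffOut, pushAll, diffSrc] using h

/-- Here `n` is the number of stacks after the current one. The target is emptied like the others
before `alt` is written. -/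
theorem reaches_drain (n : ℕ) :
    ∀ (i : Fin (Fintype.card DiffStack)) (S : DiffStack → List Sym),
      n + i.1 + 1 = Fintype.card DiffStack →
      (∀ j < i, S ((Fintype.equivFin DiffStack).symm j) = []) →
      (diffMachine cid alt).Reaches (some (drain i), S) (none, single target alt) := by
  induction n with
  | zero =>
    intro i S hi hS
    have hlt : ¬ i.1 + 1 < Fintype.card DiffStack := by omega
    refine reaches_drain_one i _ S _ rfl ?_
    refine Reaches.empty (M := diffMachine cid alt) (q := drain i) (update_self _ _ _) ?_
    simp only [diffMachine, diffNext, diffOut, hlt, dif_neg, if_neg, not_false_eq_true]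
    refine Reaches.of_eq (funext fun k => ?_)
    have hk : update S ((Fintype.equivFin DiffStack).symm i) [] k = [] := by
      by_cases h : k = (Fintype.equivFin DiffStack).symm i
      · simp [h]
      · rw [update_of_ne h]
        have := hS (Fintype.equivFin DiffStack k) (by
          rcases lt_trichotomy (Fintype.equivFin DiffStack k) i with h' | h' | h'
          · exact h'
          · exact absurd (by simp [← h']) h
          · have := (Fintype.equivFin DiffStack k).2
            have h'' : i.1 < (Fintype.equivFin DiffStack k).1 := h'
            omega)
        simpa using this
    rw [pushAll_apply, proj_toStack, hk]
    by_cases h : k = target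
    · simp [single, h]
    · simp [single, h, Ne.symm h]
  | succ n ih =>
    intro i S hi hS
    have hlt : i.1 + 1 < Fintype.card DiffStack := by omega
    refine reaches_drain_one i _ S _ rfl ?_
    refine Reaches.empty (M := diffMachine cid alt) (q := drain i) (update_self _ _ _) ?_
    simp only [diffMachine, diffNext, diffOut, hlt, dif_pos, if_pos]
    refine ih ⟨i.1 + 1, hlt⟩ _ (by simp; omega) fun j hj => ?_
    by_cases h : j = i
    · simp [pushAll, h]
    · rw [pushAll, update_of_ne (by simpa using h)]
      exact hS j (lt_of_le_of_ne (Nat.lt_succ_iff.1 hj) h)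

theorem reaches_drainFirst (S : DiffStack → List Sym) :
    (diffMachine cid alt).Reaches (some drainFirst, S) (none, single target alt) := by
  refine reaches_drain (Fintype.card DiffStack - 1) _ S ?_ fun j hj => ?_
  · have : 0 < Fintype.card DiffStack := Fintype.card_pos_iff.2 ⟨source⟩
    simp only [add_zero]
    omega
  · exact absurd hj (by simp [Fin.lt_def])

/-! ### Comparing the dimensions -/

/-- The two words are compared symbol by symbol. Each match is recorded on one of the counters,
which later control the loops over outputs and inputs; a mismatch leaves partly used stacks, which
are all discarded. -/
theorem reaches_check (u : List Sym) :
    ∀ S : DiffStack → List Sym, S (count false) = u →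
      (S (count true) = u → (diffMachine cid alt).Reaches (some check, S)
        (some (head false), pushAll (update (update S (count false) []) (count true) [])
          (u.map fun a => (counter (decide (a = .input)), a)))) ∧
      (S (count true) ≠ u → (diffMachine cid alt).Reaches (some check, S)
        (none, single target alt)) := by
  induction u with
  | nil =>
    intro S hS
    refine ⟨fun h => ?_, fun h => ?_⟩
    · refine Reaches.empty (M := diffMachine cid alt) (q := check) hS ?_
      refine Reaches.empty (M := diffMachine cid alt) (q := checkWith none) h ?_
      refine Reaches.of_eq ?_
      have h1 : update S (count false) [] = S := by rw [← hS, update_eq_self]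
      have h2 : update S (count true) [] = S := by rw [← h, update_eq_self]
      rw [h1, h2]
      rfl
    · refine Reaches.empty (M := diffMachine cid alt) (q := check) hS ?_
      obtain ⟨a, v, hv⟩ := List.exists_cons_of_ne_nil h
      refine Reaches.pop (M := diffMachine cid alt) (q := checkWith none) hv ?_
      exact reaches_drainFirst _
  | cons a u ih =>
    intro S hS
    refine ⟨fun h => ?_, fun h => ?_⟩
    · refine Reaches.pop (M := diffMachine cid alt) (q := check) hS ?_
      refine Reaches.pop (M := diffMachine cid alt) (q := checkWith (some a)) (w := u)
        (a := a) (by simpa [diffMachine, diffSrc, diffOut, pushAll] using h) ?_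
      simp only [diffMachine, diffNext, diffOut, diffSrc, pushAll, if_true, Option.isSome_some]
      refine ((ih _ ?_).1 ?_).trans (Reaches.of_eq ?_)
      · simp
      · simp
      · rw [List.map_cons, pushAll]
        congr 1
        funext k
        rcases k with _ | _ | _ | _ | (_ | _) | _ | _ <;> simp [update_apply]
    · refine Reaches.pop (M := diffMachine cid alt) (q := check) hS ?_
      simp only [diffMachine, diffNext, diffOut, diffSrc, pushAll]
      have hS' : update S (count false) u (count true) = S (count true) := by simp
      rcases hv : S (count true) with _ | ⟨a', v⟩
      · refine Reaches.empty (M := diffMachine cid alt) (q := checkWith (some a))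
          (hS'.trans hv) ?_
        exact reaches_drainFirst _
      · refine Reaches.pop (M := diffMachine cid alt) (q := checkWith (some a))
          (hS'.trans hv) ?_
        by_cases haa : a = a'
        · subst haa
          simp only [diffMachine, diffNext, diffOut, diffSrc, pushAll, if_true,
            Option.isSome_some]
          refine (ih _ ?_).2 ?_
          · simp
          · rintro h'
            apply h
            rw [hv]
            simpa using h'
        · simp only [diffMachine, diffNext, Option.some.injEq, haa, if_false]
          exact reaches_drainFirst _

/-! ### Writing the nodes that relate the two networks -/

/-- From `S` to `S'`, the word `w` has been pushed to the target and the stacks `ks` have been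
emptied. -/
def Emits (S S' : DiffStack → List Sym) (ks : List DiffStack) (w : List Sym) : Prop :=
  S' target = w ++ S target ∧ ∀ k, k ≠ target → S' k = if k ∈ ks then [] else S k

/-- A stack of names. -/
def nameBlocks (r : List NodeName) : List Sym :=
  r.flatMap fun s => (encodeBits s).reverse ++ [Sym.input]

/-- The name lies reversed above its delimiter. Moving its bits restores their order, and the
delimiter then triggers the prefix, which lands in front of the name. -/
theorem reaches_copy (i : NameUse) (s : NodeName) (v : List Sym) (S : DiffStack → List Sym)
    (c : Option DiffState × (DiffStack → List Sym))
    (hS : S (names i) = (encodeBits s).reverse ++ Sym.input :: v)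
    (h : (diffMachine cid alt).Reaches (some (afterName i),
      update (update S (names i) v) target (prefixOf cid i ++ (encodeBits s ++ S target))) c) :
    (diffMachine cid alt).Reaches (some (copy i), S) c := by
  refine Reaches.move (M := diffMachine cid alt) (q := copy i) (k := target)
    (show target ≠ names i by simp) _ _ S c ?_ ?_ hS ?_
  · simp only [encodeBits, List.mem_reverse, List.mem_map]
    rintro _ ⟨b, -, rfl⟩
    rfl
  · simp only [encodeBits, List.mem_reverse, List.mem_map]
    rintro _ ⟨b, -, rfl⟩
    rfl
  · refine Reaches.pop (M := diffMachine cid alt) (q := copy i) (a := Sym.input) (w := v) ?_ ?_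
    · simp [diffMachine, diffSrc]
    · refine (Reaches.of_eq (funext fun k => ?_)).trans h
      by_cases h1 : k = target
      · subst h1
        simp [diffMachine, diffSrc, diffOut, pushAll_apply, proj_toStack]
      · by_cases h2 : k = names i
        · subst h2
          simp [diffMachine, diffSrc, diffOut, pushAll_apply, proj_toStack]
        · simp [diffMachine, diffSrc, diffOut, pushAll_apply, proj_toStack, h1, h2, Ne.symm h1]

/-- The encoding of an output node of the difference. -/
def diffWord (cid : List Bool) (p : NodeName × NodeName) : List Sym :=
  prefixOf cid .diffName ++ (encodeBits p.1 ++ (prefixOf cid .diffLeft ++ (encodeBits p.1 ++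
    (prefixOf cid .diffRight ++ (encodeBits p.2 ++ Sym.weight :: encodeRat (-1))))))

/-- The encoding of the relay nodes of a pair of input nodes. -/
def relayWord (cid : List Bool) (p : NodeName × NodeName) : List Sym :=
  prefixOf cid .relayNameFalse ++ (encodeBits p.1 ++ (prefixOf cid .relaySrcFalse ++
    (encodeBits p.1 ++ (prefixOf cid .relayNameTrue ++ (encodeBits p.2 ++
      (prefixOf cid .relaySrcTrue ++ (encodeBits p.1 ++ Sym.weight :: encodeRat 1)))))))

theorem nameBlocks_cons (s : NodeName) (r : List NodeName) :
    nameBlocks (s :: r) = (encodeBits s).reverse ++ Sym.input :: nameBlocks r := by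
  simp [nameBlocks]

/-- Popping destroys a name, so each of its occurrences in a written node has a stack of its own.
The list `r` is in stack order, last pair first. -/
theorem reaches_diffLoop (r : List (NodeName × NodeName)) :
    ∀ S : DiffStack → List Sym, (S (counter false)).length = r.length →
      S (names .diffRight) = nameBlocks (r.map Prod.snd) →
      S (names .diffLeft) = nameBlocks (r.map Prod.fst) →
      S (names .diffName) = nameBlocks (r.map Prod.fst) →
      ∃ S', (diffMachine cid alt).Reaches (some (head false), S) (some (head false), S') ∧
        Emits S S' [counter false, names .diffRight, names .diffLeft, names .diffName]
          (r.reverse.flatMap (diffWord cid)) := by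
  induction r with
  | nil =>
    intro S h0 h1 h2 h3
    refine ⟨S, Reaches.refl _, rfl, fun k hk => ?_⟩
    split_ifs with h
    · simp only [List.mem_cons, List.not_mem_nil, or_false] at h
      rcases h with rfl | rfl | rfl | rfl
      · simpa using h0
      · exact h1
      · exact h2
      · exact h3
    · rfl
  | cons p r ih =>
    intro S h0 h1 h2 h3
    obtain ⟨a, v, hv⟩ : ∃ a v, S (counter false) = a :: v :=
      List.exists_cons_of_length_eq_add_one (by simpa using h0)
    simp only [List.map_cons, nameBlocks_cons] at h1 h2 h3
    have hlen : v.length = r.length := by rw [hv] at h0; simpa using h0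
    -- The stacks after one round: one node written, its parts produced from right to left.
    obtain ⟨S1, hS1, h4⟩ : ∃ S1 : DiffStack → List Sym,
        S1 = (fun k => if k = target then diffWord cid p ++ S target else
          if k = counter false then v else
          if k = names .diffRight then nameBlocks (r.map Prod.snd) else
          if k = names .diffLeft then nameBlocks (r.map Prod.fst) else
          if k = names .diffName then nameBlocks (r.map Prod.fst) else S k) ∧
        (diffMachine cid alt).Reaches (some (head false), S) (some (head false), S1) := by
      refine ⟨_, rfl, ?_⟩
      refine Reaches.pop (M := diffMachine cid alt) (q := head false) hv ?_
      refine reaches_copy .diffRight p.2 _ _ _ (by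
        rw [pushAll_apply]
        simpa [diffMachine, diffSrc, diffOut, proj_toStack] using h1) ?_
      refine reaches_copy .diffLeft p.1 _ _ _ (by
        simpa [pushAll_apply, diffMachine, diffSrc, diffOut, proj_toStack] using h2) ?_
      refine reaches_copy .diffName p.1 _ _ _ (by
        simpa [pushAll_apply, diffMachine, diffSrc, diffOut, proj_toStack] using h3) ?_
      refine Reaches.of_eq (funext fun k => ?_)
      simp only [update_apply, pushAll_apply, diffMachine, diffSrc, diffOut, proj_toStack]
      by_cases hk : k = target
      · subst hk; simp [diffWord]
      · simp only [hk, Ne.symm hk, if_false]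
        split_ifs <;> simp_all
    obtain ⟨S', h5, h6, h7⟩ := ih S1 (by simp [hS1, hlen]) (by simp [hS1]) (by simp [hS1])
      (by simp [hS1])
    refine ⟨S', h4.trans h5, ?_, fun k hk => ?_⟩
    · rw [h6, hS1]; simp
    · rw [h7 k hk]
      split_ifs with h
      · rfl
      · simp only [List.mem_cons, List.not_mem_nil, or_false, not_or] at h
        simp [hS1, hk, h]

theorem reaches_relayLoop (r : List (NodeName × NodeName)) :
    ∀ S : DiffStack → List Sym, (S (counter true)).length = r.length →
      S (names .relaySrcTrue) = nameBlocks (r.map Prod.fst) →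
      S (names .relayNameTrue) = nameBlocks (r.map Prod.snd) →
      S (names .relaySrcFalse) = nameBlocks (r.map Prod.fst) →
      S (names .relayNameFalse) = nameBlocks (r.map Prod.fst) →
      ∃ S', (diffMachine cid alt).Reaches (some (head true), S) (some (head true), S') ∧
        Emits S S' [counter true, names .relaySrcTrue, names .relayNameTrue,
          names .relaySrcFalse, names .relayNameFalse]
          (r.reverse.flatMap (relayWord cid)) := by
  induction r with
  | nil =>
    intro S h0 h1 h2 h3 h4
    refine ⟨S, Reaches.refl _, rfl, fun k hk => ?_⟩
    split_ifs with h
    · simp only [List.mem_cons, List.not_mem_nil, or_false] at h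
      rcases h with rfl | rfl | rfl | rfl | rfl
      · simpa using h0
      · exact h1
      · exact h2
      · exact h3
      · exact h4
    · rfl
  | cons p r ih =>
    intro S h0 h1 h2 h3 h3'
    obtain ⟨a, v, hv⟩ : ∃ a v, S (counter true) = a :: v :=
      List.exists_cons_of_length_eq_add_one (by simpa using h0)
    simp only [List.map_cons, nameBlocks_cons] at h1 h2 h3 h3'
    have hlen : v.length = r.length := by rw [hv] at h0; simpa using h0
    obtain ⟨S1, hS1, h4⟩ : ∃ S1 : DiffStack → List Sym,
        S1 = (fun k => if k = target then relayWord cid p ++ S target else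
          if k = counter true then v else
          if k = names .relaySrcTrue then nameBlocks (r.map Prod.fst) else
          if k = names .relayNameTrue then nameBlocks (r.map Prod.snd) else
          if k = names .relaySrcFalse then nameBlocks (r.map Prod.fst) else
          if k = names .relayNameFalse then nameBlocks (r.map Prod.fst) else S k) ∧
        (diffMachine cid alt).Reaches (some (head true), S) (some (head true), S1) := by
      refine ⟨_, rfl, ?_⟩
      refine Reaches.pop (M := diffMachine cid alt) (q := head true) hv ?_
      refine reaches_copy .relaySrcTrue p.1 _ _ _ (by
        rw [pushAll_apply]
        simpa [diffMachine, diffSrc, diffOut, proj_toStack] using h1) ?_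
      refine reaches_copy .relayNameTrue p.2 _ _ _ (by
        simpa [pushAll_apply, diffMachine, diffSrc, diffOut, proj_toStack] using h2) ?_
      refine reaches_copy .relaySrcFalse p.1 _ _ _ (by
        simpa [pushAll_apply, diffMachine, diffSrc, diffOut, proj_toStack] using h3) ?_
      refine reaches_copy .relayNameFalse p.1 _ _ _ (by
        simpa [pushAll_apply, diffMachine, diffSrc, diffOut, proj_toStack] using h3') ?_
      refine Reaches.of_eq (funext fun k => ?_)
      simp only [update_apply, pushAll_apply, diffMachine, diffSrc, diffOut, proj_toStack]
      by_cases hk : k = target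
      · subst hk; simp [relayWord]
      · simp only [hk, Ne.symm hk, if_false]
        split_ifs <;> simp_all
    obtain ⟨S', h5, h6, h7⟩ := ih S1 (by simp [hS1, hlen]) (by simp [hS1]) (by simp [hS1])
      (by simp [hS1]) (by simp [hS1])
    refine ⟨S', h4.trans h5, ?_, fun k hk => ?_⟩
    · rw [h6, hS1]; simp
    · rw [h7 k hk]
      split_ifs with h
      · rfl
      · simp only [List.mem_cons, List.not_mem_nil, or_false, not_or] at h
        simp [hS1, hk, h]

/-! ### Merging the layers -/

/-- A stack of layers. -/
def layerBlocks (r : List (List Sym)) : List Sym :=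
  r.flatMap fun l => l.reverse ++ [Sym.layer]

theorem layerBlocks_cons (l : List Sym) (r : List (List Sym)) :
    layerBlocks (l :: r) = l.reverse ++ Sym.layer :: layerBlocks r := by
  simp [layerBlocks]

theorem reverse_layerBlocks (r : List (List Sym)) :
    (layerBlocks r).reverse = r.reverse.flatMap (Sym.layer :: ·) := by
  induction r with
  | nil => rfl
  | cons l r ih => simp [layerBlocks_cons, ih]

theorem reaches_zipFalse_move (l v : List Sym) (hl : Sym.layer ∉ l) (S : DiffStack → List Sym)
    (c : Option DiffState × (DiffStack → List Sym))
    (hS : S (layers false) = l.reverse ++ Sym.layer :: v)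
    (h : (diffMachine cid alt).Reaches
      (some zipTrue, update (update S (layers false) v) target (l ++ S target)) c) :
    (diffMachine cid alt).Reaches (some zipFalse, S) c := by
  have hl' : ∀ a ∈ l.reverse, a ≠ Sym.layer := by
    rintro a ha rfl
    exact hl (List.mem_reverse.1 ha)
  refine Reaches.move (M := diffMachine cid alt) (q := zipFalse) (k := target)
    (show target ≠ layers false by simp) _ _ S c ?_ ?_ hS ?_
  · intro a ha
    have := hl' a ha
    cases a <;> first | rfl | exact absurd rfl this
  · intro a ha
    have := hl' a ha
    cases a <;> first | rfl | exact absurd rfl this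
  · refine Reaches.pop (M := diffMachine cid alt) (q := zipFalse) (a := Sym.layer) (w := v)
      (by simp [diffMachine, diffSrc]) ?_
    refine (Reaches.of_eq (funext fun k => ?_)).trans h
    by_cases h1 : k = target
    · subst h1; simp [diffMachine, diffSrc, diffOut, pushAll]
    · by_cases h2 : k = layers false
      · subst h2; simp [diffMachine, diffSrc, diffOut, pushAll]
      · simp [diffMachine, diffSrc, diffOut, pushAll, h1, h2]

theorem reaches_zipTrue_move (l v : List Sym) (hl : Sym.layer ∉ l) (S : DiffStack → List Sym)
    (c : Option DiffState × (DiffStack → List Sym))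
    (hS : S (layers true) = l.reverse ++ Sym.layer :: v)
    (h : (diffMachine cid alt).Reaches (some zipFalse,
      update (update S (layers true) v) target (Sym.layer :: (l ++ S target))) c) :
    (diffMachine cid alt).Reaches (some zipTrue, S) c := by
  have hl' : ∀ a ∈ l.reverse, a ≠ Sym.layer := by
    rintro a ha rfl
    exact hl (List.mem_reverse.1 ha)
  refine Reaches.move (M := diffMachine cid alt) (q := zipTrue) (k := target)
    (show target ≠ layers true by simp) _ _ S c ?_ ?_ hS ?_
  · intro a ha
    have := hl' a ha
    cases a <;> first | rfl | exact absurd rfl this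
  · intro a ha
    rfl
  · refine Reaches.pop (M := diffMachine cid alt) (q := zipTrue) (a := Sym.layer) (w := v)
      (by simp [diffMachine, diffSrc]) ?_
    refine (Reaches.of_eq (funext fun k => ?_)).trans h
    by_cases h1 : k = target
    · subst h1; simp [diffMachine, diffSrc, diffOut, pushAll]
    · by_cases h2 : k = layers true
      · subst h2; simp [diffMachine, diffSrc, diffOut, pushAll]
      · simp [diffMachine, diffSrc, diffOut, pushAll, h1, h2]

/-- The states follow the recursion of `zipLayers`, with the last layers on top. `zipFalse` swallows
its delimiter and `zipTrue` writes one, so a merged layer has a single delimiter, in front of the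
nodes of side `true`. If that side is exhausted, `zipTrue` still writes the delimiter; if side
`false` is exhausted, the rest is moved unchanged. -/
theorem reaches_zip (r : List (List Sym)) :
    ∀ (r' : List (List Sym)) (S : DiffStack → List Sym), (∀ l ∈ r, Sym.layer ∉ l) →
      (∀ l ∈ r', Sym.layer ∉ l) →
      S (layers false) = layerBlocks r → S (layers true) = layerBlocks r' →
      ∃ S', (diffMachine cid alt).Reaches (some zipFalse, S) (some (head true), S') ∧
        Emits S S' [layers false, layers true]
          ((zipLayers r r').reverse.flatMap (Sym.layer :: ·)) := by
  induction r with
  | nil =>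
    intro r' S _ _ h0 h1
    refine ⟨update (update S (layers true) []) target
      ((layerBlocks r').reverse ++ S target), ?_, ?_, fun k hk => ?_⟩
    · refine Reaches.empty (M := diffMachine cid alt) (q := zipFalse) h0 ?_
      refine Reaches.move (M := diffMachine cid alt) (q := zipRest) (k := target)
        (show target ≠ layers true by simp) (layerBlocks r') [] S _ (fun _ _ => rfl)
        (fun _ _ => rfl) (show S (layers true) = _ by rw [h1, List.append_nil]) ?_
      refine Reaches.empty (M := diffMachine cid alt) (q := zipRest)
        (by simp [diffMachine, diffSrc]) ?_
      exact Reaches.refl _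
    · simp [reverse_layerBlocks, zipLayers]
    · rw [update_of_ne hk]
      by_cases h2 : k = layers true
      · simp [h2]
      · by_cases h3 : k = layers false
        · subst h3; simpa [layerBlocks] using h0
        · simp [h2, h3]
  | cons l r ih =>
    intro r' S hr hr' h0 h1
    rw [layerBlocks_cons] at h0
    have hl := hr l (by simp)
    have hr0 : ∀ l ∈ r, Sym.layer ∉ l := fun x hx => hr x (by simp [hx])
    rcases r' with _ | ⟨l', r'⟩
    · obtain ⟨S', h2, h3, h4⟩ := ih [] (update (update S (layers false) (layerBlocks r)) target
        (Sym.layer :: (l ++ S target))) hr0 (by simp) (by simp) (by simpa using h1)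
      refine ⟨S', ?_, ?_, fun k hk => ?_⟩
      · refine reaches_zipFalse_move l _ hl S _ h0 ?_
        refine Reaches.empty (M := diffMachine cid alt) (q := zipTrue)
          (by simpa [diffMachine, diffSrc, layerBlocks] using h1) ?_
        refine (Reaches.of_eq ?_).trans h2
        simp [diffMachine, diffOut, pushAll]
      · rw [h3]
        simp [zipLayers, zipLayers_nil_right]
      · rw [h4 k hk, update_of_ne hk]
        split_ifs with h
        · rfl
        · simp only [List.mem_cons, List.not_mem_nil, or_false, not_or] at h
          rw [update_of_ne h.1]
    · rw [layerBlocks_cons] at h1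
      obtain ⟨S', h2, h3, h4⟩ := ih r' (update (update (update S (layers false) (layerBlocks r))
        (layers true) (layerBlocks r')) target (Sym.layer :: (l' ++ (l ++ S target)))) hr0
        (fun x hx => hr' x (by simp [hx])) (by simp) (by simp)
      refine ⟨S', ?_, ?_, fun k hk => ?_⟩
      · refine reaches_zipFalse_move l _ hl S _ h0 ?_
        refine reaches_zipTrue_move l' (layerBlocks r') (hr' l' (by simp)) _ _
          (by simpa using h1) ?_
        refine (Reaches.of_eq (funext fun k => ?_)).trans h2
        by_cases hk : k = target
        · simp [hk]
        · simp [update_apply, hk]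
      · rw [h3]
        simp [zipLayers]
      · rw [h4 k hk, update_of_ne hk]
        split_ifs with h
        · rfl
        · simp only [List.mem_cons, List.not_mem_nil, or_false, not_or] at h
          rw [update_of_ne h.2, update_of_ne h.1]

end Run

end NeuralNet

/-! ### Correctness of the reading phase. -/

namespace NeuralNet

open StackMachine DiffStack DiffState Function

variable {F : Set (ℝ → ℝ)}

section Emit

variable {cid : List Bool} {alt : List Sym}

/-- The target is filled from the end of the word: output nodes, merged layers, relay layer, inputs.
The hypotheses describe the stacks after a successful comparison, with `o`, `i`, `r` and `r'` in
stack order. -/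
theorem reaches_emit (S : DiffStack → List Sym) (o i : List (NodeName × NodeName))
    (r r' : List (List Sym)) (w : List Sym) (hr : ∀ l ∈ r, Sym.layer ∉ l)
    (hr' : ∀ l ∈ r', Sym.layer ∉ l)
    (hsource : S source = []) (htarget : S target = []) (hins : S ins = w.reverse)
    (hcount : ∀ b, S (count b) = [])
    (hlf : S (layers false) = layerBlocks r) (hlt : S (layers true) = layerBlocks r')
    (hco : (S (counter false)).length = o.length) (hci : (S (counter true)).length = i.length)
    (ho1 : S (names .diffRight) = nameBlocks (o.map Prod.snd))
    (ho2 : S (names .diffLeft) = nameBlocks (o.map Prod.fst))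
    (ho3 : S (names .diffName) = nameBlocks (o.map Prod.fst))
    (hi1 : S (names .relaySrcTrue) = nameBlocks (i.map Prod.fst))
    (hi2 : S (names .relayNameTrue) = nameBlocks (i.map Prod.snd))
    (hi3 : S (names .relaySrcFalse) = nameBlocks (i.map Prod.fst))
    (hi4 : S (names .relayNameFalse) = nameBlocks (i.map Prod.fst)) :
    (diffMachine cid alt).Reaches (some (head false), S) (none, single target
      (w ++ (Sym.layer :: (i.reverse.flatMap (relayWord cid) ++
        ((zipLayers r r').reverse.flatMap (Sym.layer :: ·) ++
          Sym.output :: o.reverse.flatMap (diffWord cid)))))) := by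
  obtain ⟨S2, h2, t2, k2⟩ := reaches_diffLoop (cid := cid) (alt := alt) o S hco ho1 ho2 ho3
  refine h2.trans ?_
  refine Reaches.empty (M := diffMachine cid alt) (q := head false)
    (by simp [diffMachine, diffSrc, k2]) ?_
  obtain ⟨S3, hS3⟩ : ∃ S3, S3 = pushAll S2 ((diffMachine cid alt).out (head false) none) :=
    ⟨_, rfl⟩
  have t3 : S3 target = Sym.output :: S2 target := by
    simp [hS3, diffMachine, diffOut, pushAll]
  have k3 : ∀ k, k ≠ target → S3 k = S2 k := fun k hk => by
    simp [hS3, diffMachine, diffOut, pushAll, hk]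
  rw [← hS3]
  obtain ⟨S4, h4, t4, k4⟩ := reaches_zip (cid := cid) (alt := alt) r r' S3 hr hr'
    (by simp [k3, k2, hlf]) (by simp [k3, k2, hlt])
  refine h4.trans ?_
  obtain ⟨S5, h5, t5, k5⟩ := reaches_relayLoop (cid := cid) (alt := alt) i S4
    (by simp [k4, k3, k2, hci]) (by simp [k4, k3, k2, hi1]) (by simp [k4, k3, k2, hi2])
    (by simp [k4, k3, k2, hi3]) (by simp [k4, k3, k2, hi4])
  refine h5.trans ?_
  refine Reaches.empty (M := diffMachine cid alt) (q := head true)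
    (by simp [diffMachine, diffSrc, k5]) ?_
  refine Reaches.move (M := diffMachine cid alt) (q := emitIns) (k := target)
    (show target ≠ ins by simp) w.reverse [] _ _ (fun _ _ => rfl) (fun _ _ => rfl)
    (by simp [diffMachine, diffSrc, diffOut, pushAll, k5, k4, k3, k2, hins]) ?_
  refine Reaches.empty (M := diffMachine cid alt) (q := emitIns)
    (by simp [diffMachine, diffSrc]) ?_
  refine Reaches.of_eq (funext fun k => ?_)
  by_cases hk : k = target
  · subst hk
    simp [diffMachine, diffSrc, diffOut, pushAll, single, t5, t4, t3, t2, htarget]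
  · rcases k with _ | _ | _ | (_ | _) | _ | i | (_ | _)
    · simp [diffMachine, diffSrc, diffOut, pushAll, single, k5, k4, k3, k2, hsource]
    · exact absurd rfl hk
    · simp [diffMachine, diffSrc, diffOut, pushAll, single]
    · simp [diffMachine, diffSrc, diffOut, pushAll, single, k5, k4]
    · simp [diffMachine, diffSrc, diffOut, pushAll, single, k5, k4]
    · simp [diffMachine, diffSrc, diffOut, pushAll, single, k5, k4, k3, k2, hcount]
    · cases i <;> simp [diffMachine, diffSrc, diffOut, pushAll, single, k5, k4, k3, k2]
    · simp [diffMachine, diffSrc, diffOut, pushAll, single, k5, k4, k3, k2]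
    · simp [diffMachine, diffSrc, diffOut, pushAll, single, k5]

end Emit

/-! ### Reading the two networks -/

section Read

variable (code : F → List Bool) {cid : List Bool} {alt : List Sym}

theorem flatMap_tagSym_of_fixed (b m : Bool) (w : List Sym) (h : ∀ a ∈ w, tagSym b m a = [a]) :
    w.flatMap (tagSym b m) = w := by
  induction w with
  | nil => rfl
  | cons a w ih =>
    rw [List.flatMap_cons, h a (by simp), ih fun c hc => h c (by simp [hc])]
    rfl

theorem flatMap_tagSym_bits (b m : Bool) (s : List Bool) :
    (encodeBits s).flatMap (tagSym b m) = encodeBits s := by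
  refine flatMap_tagSym_of_fixed b m _ ?_
  simp only [encodeBits, List.mem_map]
  rintro _ ⟨x, -, rfl⟩
  rfl

theorem flatMap_tagSym_rat (b m : Bool) (q : ℚ) :
    (encodeRat q).flatMap (tagSym b m) = encodeRat q := by
  simp [encodeRat, tagSym, flatMap_tagSym_bits]

theorem encodeBits_append (s t : List Bool) :
    encodeBits (s ++ t) = encodeBits s ++ encodeBits t := by
  simp [encodeBits]

/-- After `act`, the only names of nodes are the sources of edges, each directly behind the symbol
`edge`; activation names and numbers must stay untagged. -/
theorem flatMap_tagSym_nodeTail (b m : Bool) (v : Node F) :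
    (nodeTail code v).flatMap (tagSym b m) = nodeTail code (tagNode (sideTag b) v) := by
  simp [nodeTail, tagNode, flatMap_tagSym_bits, flatMap_tagSym_rat, tagSym, List.flatMap_map,
    List.flatMap_assoc, encodeEdge, encodeBits_append]

/-- The encoding of a tagged node with a mark. -/
def nodeWord (b m : Bool) (v : Node F) : List Sym :=
  Sym.node :: Sym.mark m :: (encodeBits (sideTag b ++ v.name) ++
    Sym.act :: nodeTail code (tagNode (sideTag b) v))

theorem flatMap_tagSym_node (b m : Bool) (v : Node F) :
    (encodeNode code ∅ v).flatMap (tagSym b m) = nodeWord code b m v := by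
  simp [encodeNode_eq, nodeWord, flatMap_tagSym_bits, flatMap_tagSym_nodeTail, tagSym,
    encodeBits_append]

/-- The pushes caused by the name of an input node. -/
def inLog (b : Bool) (s : NodeName) : List (DiffStack × Sym) :=
  ((count b, .input) :: spread (inStacks b) [.input] ++
    bif b then [] else toStack ins (.input :: encodeBits inTag)) ++
    (encodeBits s).flatMap fun a => spread (inStacks b) [a] ++ bif b then [] else toStack ins [a]

/-- The pushes caused by an output node. -/
def outLog (b : Bool) (v : Node F) : List (DiffStack × Sym) :=
  toStack (layers b) [.node] ++
    (((count b, .node) :: spread (outStacks b) [.input] ++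
      toStack (layers b) (.mark true :: encodeBits (sideTag b))) ++
    (((encodeBits v.name).flatMap fun a => (layers b, a) :: spread (outStacks b) [a]) ++
    (toStack (layers b) [.act] ++
      toStack (layers b) (nodeTail code (tagNode (sideTag b) v)))))

/-- The encoding of the tagged hidden layers, followed by the beginning of another layer. -/
def hiddenWord (b : Bool) (ls : List (List (Node F))) : List Sym :=
  ls.flatMap (fun l => Sym.layer :: l.flatMap (nodeWord code b false)) ++ [Sym.layer]

/-- The pushes caused by a network. -/
def networkLog (b : Bool) (N : Network F) : List (DiffStack × Sym) :=
  N.inputs.flatMap (inLog b) ++ (toStack (layers b) (hiddenWord code b N.hidden) ++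
    N.output.flatMap (outLog code b))

theorem toStack_flatMap (k : DiffStack) (f : Sym → List Sym) (w : List Sym) :
    (w.flatMap fun a => toStack k (f a)) = toStack k (w.flatMap f) := by
  simp [toStack, List.map_flatMap]

theorem reads_inName (b : Bool) (s : NodeName) :
    (diffMachine cid alt).Reads source (readIn b) (Sym.input :: encodeBits s) (readIn b)
      (inLog b s) := by
  refine Reads.cons (M := diffMachine cid alt) rfl rfl ?_
    (Reads.loop (M := diffMachine cid alt) (k := source) (q := readIn b)
      (f := fun a => spread (inStacks b) [a] ++ bif b then [] else toStack ins [a]) rfl _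
    ?_ ?_ ?_)
  · cases b <;> simp [diffMachine, diffOut, inStacks, spread, proj_toStack]
  · simp only [encodeBits, List.mem_map]
    rintro _ ⟨x, -, rfl⟩
    rfl
  · simp only [encodeBits, List.mem_map]
    rintro _ ⟨x, -, rfl⟩
    rfl
  · intro a _
    cases b <;> simp [inStacks, spread, proj_toStack]

theorem reads_ins (b : Bool) (l : List NodeName) :
    (diffMachine cid alt).Reads source (readIn b)
      (l.flatMap fun s => Sym.input :: encodeBits s) (readIn b) (l.flatMap (inLog b)) := by
  obtain ⟨q, rfl, h⟩ := Reads.flatMap (M := diffMachine cid alt) (k := source)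
    (· = readIn b) (fun s => Sym.input :: encodeBits s) (inLog b) l
    (by rintro s - q rfl; exact ⟨_, rfl, reads_inName b s⟩) _ rfl
  exact h

theorem output_not_mem_node (v : Node F) : Sym.output ∉ encodeNode code ∅ v := by
  intro h
  have h2 := inner_nodeTail code v Sym.output
  simp [encodeNode_eq, encodeBits] at h
  simpa [Sym.inner] using h2 h

theorem reads_hid (b : Bool) (w : List Sym) (hw : Sym.output ∉ w) :
    (diffMachine cid alt).Reads source (readHid b) w (readHid b)
      (toStack (layers b) (w.flatMap (tagSym b false))) := by
  rw [← toStack_flatMap]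
  have h : ∀ a ∈ w, a ≠ Sym.output := by
    rintro a ha rfl
    exact hw ha
  refine Reads.loop (M := diffMachine cid alt) (k := source) (q := readHid b) rfl _ _ ?_ ?_ ?_
  · intro a ha
    have := h a ha
    cases a <;> first | rfl | exact absurd rfl this
  · intro a ha
    have := h a ha
    cases a <;> first | rfl | exact absurd rfl this
  · intro a _
    simp [proj_toStack]

/-- The symbol `output` is replaced by `layer`, because the old output layer becomes hidden. Without
hidden layers the machine passes directly from `readIn` to `readOut`. -/
theorem reads_hidden (b : Bool) (ls : List (List (Node F))) :
    (diffMachine cid alt).Reads source (readIn b)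
      (ls.flatMap (fun l => Sym.layer :: l.flatMap (encodeNode code ∅)) ++ [Sym.output])
      (readOut b) (toStack (layers b) (hiddenWord code b ls)) := by
  rcases ls with _ | ⟨l, ls⟩
  · exact Reads.singleton (M := diffMachine cid alt) (q := readIn b) (a := Sym.output) rfl rfl
      (by simp [diffMachine, diffOut])
  · have h1 := Reads.singleton (M := diffMachine cid alt) (k := source) (q := readIn b)
      (a := Sym.layer) rfl rfl (by simp [diffMachine, diffOut])
    have h2 := reads_hid (cid := cid) (alt := alt) b (l.flatMap (encodeNode code ∅) ++
      ls.flatMap fun l => Sym.layer :: l.flatMap (encodeNode code ∅)) (by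
        simp [output_not_mem_node])
    have h3 := Reads.singleton (M := diffMachine cid alt) (k := source) (q := readHid b)
      (a := Sym.output) rfl rfl (by simp [diffMachine, diffOut])
    refine (h1.append (h2.append h3)).congr (by simp) ?_
    simp [diffMachine, diffOut, hiddenWord, toStack, List.flatMap_assoc, flatMap_tagSym_node,
      tagSym]

theorem reads_outNode (b : Bool) (v : Node F) :
    (diffMachine cid alt).Reads source (readOut b) (encodeNode code ∅ v) (readOut b)
      (outLog code b v) := by
  have h1 := Reads.singleton (M := diffMachine cid alt) (k := source) (q := readOut b)
    (a := Sym.node) rfl rfl (by simp [diffMachine, diffOut, proj_toStack])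
  have h2 := Reads.singleton (M := diffMachine cid alt) (k := source) (q := readOut b)
    (a := Sym.mark false) rfl rfl (by
      cases b <;> simp [diffMachine, diffOut, proj_toStack, outStacks, spread])
  have h3 : (diffMachine cid alt).Reads source (readName b) (encodeBits v.name) (readName b)
      ((encodeBits v.name).flatMap fun a => (layers b, a) :: spread (outStacks b) [a]) := by
    refine Reads.loop (M := diffMachine cid alt) (k := source) (q := readName b) rfl _ _ ?_ ?_ ?_
    · simp only [encodeBits, List.mem_map]
      rintro _ ⟨x, -, rfl⟩
      rfl
    · simp only [encodeBits, List.mem_map]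
      rintro _ ⟨x, -, rfl⟩
      rfl
    · intro a _
      cases b <;> simp [outStacks, spread]
  have h4 := Reads.singleton (M := diffMachine cid alt) (k := source) (q := readName b)
    (a := Sym.act) rfl rfl (by simp [diffMachine, diffOut])
  have h5 : (diffMachine cid alt).Reads source (readOut b) (nodeTail code v) (readOut b)
      (toStack (layers b) (nodeTail code (tagNode (sideTag b) v))) := by
    rw [← flatMap_tagSym_nodeTail code b true, ← toStack_flatMap]
    refine Reads.loop (M := diffMachine cid alt) (k := source) (q := readOut b) rfl _ _ ?_ ?_ ?_
    · intro a ha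
      have := inner_nodeTail code v a ha
      cases a <;> first | rfl | simp [Sym.inner] at this
    · intro a ha
      have := inner_nodeTail code v a ha
      cases a <;> first | rfl | simp [Sym.inner] at this
    · intro a _
      simp [proj_toStack]
  refine (h1.append (h2.append (h3.append (h4.append h5)))).congr ?_ rfl
  simp [encodeNode_eq]

theorem reads_network (b : Bool) (N : Network F) :
    (diffMachine cid alt).Reads source (readIn b) (encodeNetwork code N ∅) (readOut b)
      (networkLog code b N) := by
  obtain ⟨q, rfl, h⟩ := Reads.flatMap (M := diffMachine cid alt) (k := source)
    (· = readOut b) (encodeNode code ∅) (outLog code b) N.output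
    (by rintro v - q rfl; exact ⟨_, rfl, reads_outNode code b v⟩) _ rfl
  refine ((reads_ins b N.inputs).append ((reads_hidden code b N.hidden).append h)).congr ?_ rfl
  simp [encodeNetwork]

/-- The pushes caused by two networks. -/
def pairLog (P : Bool → Network F) : List (DiffStack × Sym) :=
  networkLog code false (P false) ++ networkLog code true (P true)

theorem reads_pair (P : Bool → Network F) :
    (diffMachine cid alt).Reads source (readIn false)
      (encodeNetwork code (P false) ∅ ++ Sym.next :: encodeNetwork code (P true) ∅)
      (readOut true) (pairLog code P) :=
  (reads_network code false (P false)).append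
    (Reads.cons (M := diffMachine cid alt) (q := readOut false) (a := Sym.next) rfl rfl rfl
      (reads_network code true (P true)))

/-! ### The stacks after reading -/

variable (P : Bool → Network F)

theorem flatMap_const_nil {α β : Type*} (l : List α) : (l.flatMap fun _ => ([] : List β)) = [] := by
  simp

theorem flatMap_const_singleton {α β : Type*} (l : List α) (c : β) :
    (l.flatMap fun _ => [c]) = l.map fun _ => c := List.flatMap_pure_eq_map (fun _ => c) l

theorem proj_pairLog_source : proj source (pairLog code P) = [] := by
  simp [pairLog, networkLog, inLog, outLog, proj_flatMap, proj_toStack, proj_spread, inStacks,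
    outStacks, flatMap_const_nil]

theorem proj_pairLog_target : proj target (pairLog code P) = [] := by
  simp [pairLog, networkLog, inLog, outLog, proj_flatMap, proj_toStack, proj_spread, inStacks,
    outStacks, flatMap_const_nil]

theorem proj_pairLog_counter (b : Bool) : proj (counter b) (pairLog code P) = [] := by
  simp [pairLog, networkLog, inLog, outLog, proj_flatMap, proj_toStack, proj_spread, inStacks,
    outStacks, flatMap_const_nil]

theorem proj_pairLog_ins : proj ins (pairLog code P) =
    ((P false).inputs.map (inTag ++ ·)).flatMap fun s => Sym.input :: encodeBits s := by
  simp [pairLog, networkLog, inLog, outLog, proj_flatMap, proj_toStack, proj_spread, inStacks,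
    outStacks, flatMap_const_nil, List.flatMap_map, encodeBits_append]

theorem proj_pairLog_layers (b : Bool) : proj (layers b) (pairLog code P) =
    hiddenWord code b (P b).hidden ++ (P b).output.flatMap (nodeWord code b true) := by
  have h : ∀ b, nodeWord code b true = fun v => Sym.node :: Sym.mark true ::
      (encodeBits (sideTag b) ++ (encodeBits v.name ++
        Sym.act :: nodeTail code (tagNode (sideTag b) v))) := by
    intro b
    funext v
    simp [nodeWord, encodeBits_append]
  cases b <;>
  simp [pairLog, networkLog, inLog, outLog, proj_flatMap, proj_toStack, proj_spread, inStacks,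
    outStacks, flatMap_const_nil, h]

/-- The word that tells the dimensions of a network. -/
def dimWord (N : Network F) : List Sym :=
  N.inputs.map (fun _ => Sym.input) ++ N.output.map fun _ => Sym.node

theorem proj_pairLog_count (b : Bool) : proj (count b) (pairLog code P) = dimWord (P b) := by
  cases b <;>
  simp [pairLog, networkLog, inLog, outLog, proj_flatMap, proj_toStack, proj_spread, inStacks,
    outStacks, flatMap_const_nil, dimWord, flatMap_const_singleton]

theorem dimWord_eq_iff : dimWord (P true) = dimWord (P false) ↔ SameDims P := by
  constructor
  · intro h
    have h1 := congrArg (List.count Sym.input) h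
    have h2 := congrArg (List.count Sym.node) h
    simp [dimWord, List.map_const', List.count_replicate] at h1 h2
    exact ⟨h1.symm, h2.symm⟩
  · rintro ⟨h1, h2⟩
    simp [dimWord, List.map_const', h1, h2]

/-- A sequence of names, each after a delimiter. -/
def nameWord (l : List NodeName) : List Sym := l.flatMap fun s => Sym.input :: encodeBits s

theorem reverse_nameWord (l : List NodeName) :
    (nameWord l).reverse = nameBlocks l.reverse := by
  induction l with
  | nil => rfl
  | cons s l ih =>
    rw [nameWord, List.flatMap_cons, List.reverse_append, ← nameWord, ih]
    simp [nameBlocks]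

theorem proj_pairLog_inNames (b : Bool) (i : NameUse) (hi : names i ∈ inStacks b) :
    proj (names i) (pairLog code P) = nameWord (P b).inputs := by
  cases b <;> cases i <;> simp [inStacks] at hi <;>
  simp [pairLog, networkLog, inLog, outLog, proj_flatMap, proj_toStack, proj_spread, inStacks,
    outStacks, flatMap_const_nil, nameWord]

theorem proj_pairLog_outNames (b : Bool) (i : NameUse) (hi : names i ∈ outStacks b) :
    proj (names i) (pairLog code P) = nameWord (layerNames (P b).output) := by
  cases b <;> cases i <;> simp [outStacks] at hi <;>
  simp [pairLog, networkLog, inLog, outLog, proj_flatMap, proj_toStack, proj_spread, inStacks,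
    outStacks, flatMap_const_nil, nameWord, layerNames, List.flatMap_map]

end Read

end NeuralNet

/-! ### Assembly of the two reductions. -/

namespace NeuralNet

open StackMachine DiffStack DiffState Function

variable {F : Set (ℝ → ℝ)}

section Assemble

variable (code : F → List Bool) (hid : (id : ℝ → ℝ) ∈ F) (P : Bool → Network F)

theorem encodeNode_tagNode (b : Bool) (v : Node F) :
    encodeNode code (diffSet P) (tagNode (sideTag b) v) =
      nodeWord code b (decide (v.name ∈ layerNames (P b).output)) v := by
  rw [encodeNode_eq, nodeWord]
  simp only [tagNode, mem_diffSet]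

/-- The encoding of the nodes of a layer. -/
def layerWord (l : List (Node F)) : List Sym := l.flatMap (encodeNode code (diffSet P))

theorem layer_not_mem_layerWord (l : List (Node F)) : Sym.layer ∉ layerWord code P l := by
  intro h
  obtain ⟨v, -, hv⟩ := List.mem_flatMap.1 h
  have h2 := inner_nodeTail code v Sym.layer
  simp [encodeNode_eq, encodeBits] at hv
  simpa [Sym.inner] using h2 hv

/-- The machine marks exactly the nodes read in the output part. These are the right marks for
`diffSet`, since no hidden node shares its name with an output node. -/
theorem layers_reverse (b : Bool) :
    (hiddenWord code b (P b).hidden ++ (P b).output.flatMap (nodeWord code b true)).reverse =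
      layerBlocks ((tagLayers (sideTag b) (revLayers (P b))).map (layerWord code P)) := by
  rw [← List.reverse_inj, List.reverse_reverse, reverse_layerBlocks, ← List.map_reverse,
    tagLayers_reverse, revLayers_reverse]
  have hh : ∀ l ∈ (P b).hidden, l.flatMap (nodeWord code b false) =
      layerWord code P (l.map (tagNode (sideTag b))) := by
    intro l hl
    rw [layerWord, List.flatMap_map]
    refine List.flatMap_congr fun v hv => ?_
    have : v.name ∉ layerNames (P b).output := Network.not_mem_output_of_hidden
      (List.mem_flatMap.2 ⟨l, hl, List.mem_map_of_mem hv⟩)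
    rw [encodeNode_tagNode, decide_eq_false this]
  have ho : (P b).output.flatMap (nodeWord code b true) =
      layerWord code P ((P b).output.map (tagNode (sideTag b))) := by
    rw [layerWord, List.flatMap_map]
    refine List.flatMap_congr fun v hv => ?_
    have : v.name ∈ layerNames (P b).output := List.mem_map_of_mem hv
    rw [encodeNode_tagNode, decide_eq_true this]
  rw [hiddenWord, ho, List.flatMap_congr fun l hl => by rw [hh l hl]]
  simp [tagLayers, List.flatMap_map]

theorem map_zipLayers {α β : Type*} (f : List α → List β)
    (hf : ∀ a b, f (a ++ b) = f a ++ f b) (as bs : List (List α)) :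
    (zipLayers as bs).map f = zipLayers (as.map f) (bs.map f) := by
  induction as, bs using zipLayers.induct with
  | case1 bs => rfl
  | case2 a as => rfl
  | case3 a as b bs ih => simp [zipLayers, hf, ih]

theorem encode_relays (p : NodeName × NodeName) (hp : p ∈ inPairs P) :
    (relays hid p).flatMap (encodeNode code (diffSet P)) =
      relayWord (code (idAct hid)) p := by
  have h1 : sideTag false ++ p.1 ∉ diffSet P := by
    rw [mem_diffSet]
    exact fun h => List.disjoint_of_nodup_append (P false).hiddenNames_nodup_append
      (List.of_mem_zip hp).1 (List.mem_append_right _ h)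
  have h2 : sideTag true ++ p.2 ∉ diffSet P := by
    rw [mem_diffSet]
    exact fun h => List.disjoint_of_nodup_append (P true).hiddenNames_nodup_append
      (List.of_mem_zip hp).2 (List.mem_append_right _ h)
  simp [relays, relay, encodeNode_eq, h1, h2, relayWord, prefixOf, encodeBits_append, nodeTail,
    zeroTail, encodeEdge]

theorem encode_diffNode (p : NodeName × NodeName) :
    encodeNode code (diffSet P) (diffNode hid p) = diffWord (code (idAct hid)) p := by
  have h : outTag ++ p.1 ∉ diffSet P := by simp [diffSet, outTag, sideTag]
  simp [diffNode, encodeNode_eq, h, diffWord, prefixOf, encodeBits_append, nodeTail,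
    zeroTail, encodeEdge]

variable {P}

theorem encode_diffNetwork (h : SameDims P) :
    encodeNetwork code (diffNetwork hid h) (diffSet P) =
      ((P false).inputs.map (inTag ++ ·)).flatMap (fun s => Sym.input :: encodeBits s) ++
      (Sym.layer :: ((inPairs P).flatMap (relayWord (code (idAct hid))) ++
        ((zipLayers ((tagLayers (sideTag false) (revLayers (P false))).map (layerWord code P))
          ((tagLayers (sideTag true) (revLayers (P true))).map
            (layerWord code P))).reverse.flatMap (Sym.layer :: ·) ++
          Sym.output :: (outPairs P).flatMap (diffWord (code (idAct hid)))))) := by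
  rw [← map_zipLayers _ (fun a b => by simp [layerWord]),
    ← List.flatMap_congr fun p hp => encode_relays code hid P p hp,
    ← List.flatMap_congr fun p _ => encode_diffNode code hid P p]
  simp only [encodeNetwork, diffNetwork, diffHidden, mergedLayers, List.flatMap_cons,
    List.flatMap_map, List.flatMap_assoc, ← List.map_reverse, layerWord]
  simp

variable (P)

/-- The input word of the machine for a pair of networks. -/
def pairWord : List Sym :=
  encodeNetwork code (P false) ∅ ++ Sym.next :: encodeNetwork code (P true) ∅

/-- The stacks after reading a pair of networks. -/
def pairStacks : DiffStack → List Sym := fun k => (proj k (pairLog code P)).reverse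

variable {cid : List Bool} {alt : List Sym}

theorem reaches_read : (diffMachine cid alt).Reaches
    (some (readIn false), single source (pairWord code P)) (some check, pairStacks code P) := by
  have h := reads_pair (cid := cid) (alt := alt) code P
  refine (h.2 _ [] (by simp [single, pairWord])).trans ?_
  refine Reaches.empty (M := diffMachine cid alt) (q := readOut true) ?_ ?_
  · simp [diffMachine, diffSrc, pushAll_apply, proj_pairLog_source]
  · refine Reaches.of_eq (funext fun k => ?_)
    simp only [diffMachine, diffOut, pushAll_apply, pairStacks]
    by_cases hk : k = source
    · simp [hk]
    · simp [single, hk]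

theorem reaches_alt (h : ¬ SameDims P) : (diffMachine cid alt).Reaches
    (some (readIn false), single source (pairWord code P)) (none, single target alt) := by
  refine (reaches_read code P).trans ((reaches_check _ _ rfl).2 ?_)
  rw [pairStacks, pairStacks, proj_pairLog_count, proj_pairLog_count, Ne, List.reverse_inj,
    dimWord_eq_iff]
  exact h

/-- `counter true` receives one symbol per input and `counter false` one per output. -/
theorem length_proj_counter (b : Bool) (N : Network F) :
    (proj (counter b) ((dimWord N).reverse.map fun a => (counter (decide (a = .input)), a))).length =
      if b then N.inputs.length else N.output.length := by
  have h1 : ((N.inputs.map fun _ => Sym.input).map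
      fun a => (counter (decide (a = .input)), a)) =
      toStack (counter true) (N.inputs.map fun _ => Sym.input) := by
    simp [toStack]
  have h2 : ((N.output.map fun _ => Sym.node).map
      fun a => (counter (decide (a = .input)), a)) =
      toStack (counter false) (N.output.map fun _ => Sym.node) := by
    simp [toStack]
  have hrev : ∀ l : List (DiffStack × Sym), (proj (counter b) l.reverse).length =
      (proj (counter b) l).length := by
    intro l
    simp [proj, List.filterMap_reverse]
  rw [List.map_reverse, hrev, dimWord, List.map_append, h1, h2, proj_append, proj_toStack,
    proj_toStack]
  cases b <;> simp

variable {P}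

theorem reaches_diffNetwork (h : SameDims P) : (diffMachine (code (idAct hid)) alt).Reaches
    (some (readIn false), single source (pairWord code P))
    (none, single target (encodeNetwork code (diffNetwork hid h) (diffSet P))) := by
  have hc : pairStacks code P (count true) = pairStacks code P (count false) := by
    rw [pairStacks, pairStacks, proj_pairLog_count, proj_pairLog_count, (dimWord_eq_iff P).2 h]
  refine (reaches_read code P).trans (((reaches_check _ _ rfl).1 hc).trans ?_)
  have hu : pairStacks code P (count false) = (dimWord (P false)).reverse := by
    rw [pairStacks, proj_pairLog_count]
  -- The stacks hold the pairs last first, so `reaches_emit` is applied to the reversed lists of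
  -- pairs.
  rw [hu, encode_diffNetwork, ← List.reverse_reverse (inPairs P),
    ← List.reverse_reverse (outPairs P)]
  have hother : ∀ k, (∀ b, k ≠ counter b) → proj k ((dimWord (P false)).map
      fun a => (counter (decide (a = .input)), a)).reverse = [] := by
    intro k hk
    simp [proj, fun b => Ne.symm (hk b)]
  have hn : ∀ i, (proj (names i) (pairLog code P)).reverse =
      pushAll (update (update (pairStacks code P) (count false) []) (count true) [])
        ((dimWord (P false)).reverse.map fun a => (counter (decide (a = .input)), a))
        (names i) := by
    intro i
    simp [pushAll_apply, hother, pairStacks]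
  refine reaches_emit _ _ _ _ _ _ ?_ ?_ ?_ ?_ ?_ ?_ ?_ ?_ ?_ ?_ ?_ ?_ ?_ ?_ ?_ ?_ ?_
  · simp only [List.mem_map]
    rintro _ ⟨l, -, rfl⟩
    exact layer_not_mem_layerWord code P l
  · simp only [List.mem_map]
    rintro _ ⟨l, -, rfl⟩
    exact layer_not_mem_layerWord code P l
  · simp [pushAll_apply, hother, pairStacks, proj_pairLog_source]
  · simp [pushAll_apply, hother, pairStacks, proj_pairLog_target]
  · simp [pushAll_apply, hother, pairStacks, proj_pairLog_ins]
  · rintro (_ | _) <;> simp [pushAll_apply, hother]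
  · rw [← layers_reverse, ← proj_pairLog_layers]
    simp [pushAll_apply, hother, pairStacks]
  · rw [← layers_reverse, ← proj_pairLog_layers]
    simp [pushAll_apply, hother, pairStacks]
  · rw [pushAll_apply, List.length_append, List.length_reverse, length_proj_counter]
    simp [pairStacks, proj_pairLog_counter, outPairs, layerNames, h.2]
  · rw [pushAll_apply, List.length_append, List.length_reverse, length_proj_counter]
    simp [pairStacks, proj_pairLog_counter, inPairs, h.1]
  · rw [← hn, proj_pairLog_outNames code P true _ (by simp [outStacks]), List.map_reverse,
      outPairs_snd h, reverse_nameWord]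
  · rw [← hn, proj_pairLog_outNames code P false _ (by simp [outStacks]), List.map_reverse,
      outPairs_fst h, reverse_nameWord]
  · rw [← hn, proj_pairLog_outNames code P false _ (by simp [outStacks]), List.map_reverse,
      outPairs_fst h, reverse_nameWord]
  · rw [← hn, proj_pairLog_inNames code P false _ (by simp [inStacks]), List.map_reverse,
      inPairs_fst h, reverse_nameWord]
  · rw [← hn, proj_pairLog_inNames code P true _ (by simp [inStacks]), List.map_reverse,
      inPairs_snd h, reverse_nameWord]
  · rw [← hn, proj_pairLog_inNames code P false _ (by simp [inStacks]), List.map_reverse,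
      inPairs_fst h, reverse_nameWord]
  · rw [← hn, proj_pairLog_inNames code P false _ (by simp [inStacks]), List.map_reverse,
      inPairs_fst h, reverse_nameWord]

end Assemble

/-! ### The reductions -/

section Reductions

variable (code : F → List Bool) (hid : (id : ℝ → ℝ) ∈ F)

/-- Map a network with marked nodes to the network and the same network with the marked nodes
silenced. -/
def silenceReduction (I : NECEInstance F) : Network F × Network F :=
  (I.N, I.N.silence hid I.Y)

theorem silenceReduction_correct (I : NECEInstance F) :
    ¬ (NECE F code).yes I ↔ (NE F code).yes (silenceReduction hid I) := by
  simp only [NECE, NE, silenceReduction, not_not]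
  exact I.N.sameFunction_delete_iff hid I.Y I.hidden_Y

/-- A pair as a family. -/
def pairFamily (I : Network F × Network F) : Bool → Network F := fun b => bif b then I.2 else I.1

open Classical in
/-- Map a pair of networks to their difference with the nodes marked that it subtracts; if the
dimensions differ, to a network with a necessary node. -/
noncomputable def diffReduction (I : Network F × Network F) : NECEInstance F :=
  if h : SameDims (pairFamily I) then ⟨diffNetwork hid h, diffSet (pairFamily I), diffSet_hidden hid h⟩
  else ⟨oneNetwork hid, {[]}, by simp [oneNetwork, Network.hiddenNames, layerNames]⟩

theorem diffReduction_correct (I : Network F × Network F) :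
    (NE F code).yes I ↔ ¬ (NECE F code).yes (diffReduction hid I) := by
  simp only [NECE, NE, not_not, diffReduction]
  split_ifs with h
  · exact (diffNetwork_sameFunction_iff hid h).symm
  · refine iff_of_false (fun h' => h (sameDims_of_sameFunction (P := pairFamily I) h')) ?_
    exact oneNetwork_not_sameFunction hid

theorem diffReduction_isStrict (I : Network F × Network F) (h1 : I.1.IsStrict) (h2 : I.2.IsStrict)
    (hl : I.1.hidden.length = I.2.hidden.length) : (diffReduction hid I).N.IsStrict := by
  unfold diffReduction
  split_ifs with h
  · exact diffNetwork_isStrict hid h (by rintro (_ | _) <;> assumption) hl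
  · exact oneNetwork_isStrict hid

theorem reaches_silenceReduction (I : NECEInstance F) :
    (silenceMachine (code (idAct hid))).Reaches
      (some .copy, single .source ((NECE F code).encode I))
      (none, single .target ((NE F code).encode (silenceReduction hid I))) :=
  reaches_silence code I.Y hid I.N

theorem reaches_diffReduction (I : Network F × Network F) :
    (diffMachine (code (idAct hid)) (encodeNetwork code (oneNetwork hid) {[]})).Reaches
      (some (readIn false), single source ((NE F code).encode I))
      (none, single target ((NECE F code).encode (diffReduction hid I))) := by
  simp only [NECE, diffReduction]
  split_ifs with h
  · exact reaches_diffNetwork code hid h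
  · exact reaches_alt code (pairFamily I) h

end Reductions

end NeuralNet

open NeuralNet

theorem mainTheorem7 (F : Set (ℝ → ℝ)) (code : F → List Bool)
    (hcode : Function.Injective code) (hid : (id : ℝ → ℝ) ∈ F) :
    NeuralNet.DecisionProblem.LinearTimeEquivalent
        (NeuralNet.NECE F code).compl (NeuralNet.NE F code) ∧
      NeuralNet.DecisionProblem.LinearTimeEquivalent
        (NeuralNet.strictNECE F code).compl (NeuralNet.strictNE F code) := by
  -- The strict case uses the same maps and machines: restriction does not change the encoding, so
  -- only strictness and equality of the numbers of layers have to be added.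
  refine ⟨⟨⟨silenceReduction hid, silenceReduction_correct code hid, ?_⟩,
    ⟨diffReduction hid, diffReduction_correct code hid, ?_⟩⟩,
    ⟨⟨fun I => ⟨silenceReduction hid I.1, I.2, I.1.N.isStrict_silence hid _ I.2,
        by simp [silenceReduction, Network.silence]⟩,
      fun I => silenceReduction_correct code hid I.1, ?_⟩,
    ⟨fun I => ⟨diffReduction hid I.1, diffReduction_isStrict hid I.1 I.2.1 I.2.2.1 I.2.2.2⟩,
      fun I => diffReduction_correct code hid I.1, ?_⟩⟩⟩
  · exact StackMachine.exists_computableInTime _ (silenceMachine_decreasing _) _ _ _ _ _ _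
      (reaches_silenceReduction code hid)
  · exact StackMachine.exists_computableInTime _ (diffMachine_decreasing _ _) _ _ _ _ _ _
      (reaches_diffReduction code hid)
  · exact StackMachine.exists_computableInTime _ (silenceMachine_decreasing _) _ _ _ _ _ _
      fun I => reaches_silenceReduction code hid I.1
  · exact StackMachine.exists_computableInTime _ (diffMachine_decreasing _ _) _ _ _ _ _ _
      fun I => reaches_diffReduction code hid I.1
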